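/- Let $m,n\ge 1$ and let $G\subseteq K_{m,n}$ be a bipartite graph without isolated vertices, with left vertices $1,\dots,m$ and right vertices $\bar 1,\dots,\bar n$. Let $y_1,\dots,y_m$ be nonnegative integers such that deleting from $G$ the left vertices $i$ with $y_i=0$ leaves a connected graph (so, if all $y_i>0$, this says that $G$ is connected). For $I\subseteq[n]$ let $\Delta_I=\mathrm{conv}(e_j : j\in I)\subset\mathbb R^n$, and for $j\in I$ let $\Delta^*_{I,j}=\Delta_I\setminus\Delta_{I\setminus\{j\}}$. For a subgraph $H$ of $G$ on the same vertex set let $H_i\subseteq [n]$ be the set of neighbours of the left vertex $i$ in $H$ (right vertices $\bar j$ being identified with $j$), and put $\prod_H=y_1\Delta_{H_1}+\dots+y_m\Delta_{H_m}$. Let $P_G=\prod_G$, a polytope of dimension $n-1$ in the hyperplane $\sum_j x_j=\sum_i y_i$, and let $P_G^-=\{x\in\mathbb R^n : x+\Delta_{[n]}\subseteq P_G\}$. A facet $F$ of $P_G$ is called negative if, for all sufficiently large $c$, the affine span of $F$ (a hyperplane inside $\sum_j x_j=\sum_i y_i$) strictly separates the point $((n-1)c+\sum_i y_i,-c,\dots,-c)$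 from the relative interior of $P_G$; otherwise $F$ is called positive. A fine mixed subdivision of $P_G$ is a set of polytopes (cells) with union $P_G$ such that the intersection of any two of them is a (possibly empty) face of both, and such that each cell has dimension $n-1$ and can be written as $B_1+\dots+B_m$, where each $B_i$ is a simplex that is the convex hull of a nonempty set of vertices of $y_i\Delta_{G_i}$, and $\sum_i\dim B_i=n-1$. Fix any fine mixed subdivision of $P_G$. Then: 1. The map $p\mapsto p+e_1$ is a bijection from the lattice points of $P_G^-$ onto the lattice points of $P_G$ that lie on no positive facet of $P_G$. 2. Every cell is of the form $\prod_T$ for a spanning tree $T$ of $G$. For every spanning tree $T$ of $G$ and every left vertex $i$ there is a unique $t_i\in T_i$ from which there is a path in $T$ to $\bar 1$ that does not pass through $i$ (in particular $t_i=\bar 1$ if $\bar 1\in T_i$). 3. Write each cell, in any way, as $\prod_T$ with $T$ a spanning tree of $G$, and assign to it the semi-polytope $\sum_i y_i\Delta^*_{T_i,t_i}$. The semi-polytopes of different cells are disjoint, and their union is $P_G$ with all its positive facets removed. For each lattice point $p$ of $P_G^-$, the point $p+e_1$ lies in the semi-polytope of exactly one cell. -/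

import Mathlib

open scoped Pointwise

noncomputable section

namespace GenPerm

/-! ### Polytopes, Minkowski cells and fine mixed subdivisions -/

section Minkowski

variable {E : Type*} [AddCommGroup E] [Module ℝ E]

/-- The dimension of the affine hull of a (nonempty) set. -/
def dim (S : Set E) : ℕ := Module.finrank ℝ (vectorSpan ℝ S)

/-- A simplex: the convex hull of a nonempty finite affinely independent set. -/
def IsSimplex (B : Set E) : Prop :=
  ∃ S : Set E, S.Nonempty ∧ S.Finite ∧ AffineIndependent ℝ ((↑) : S → E) ∧ B = convexHull ℝ S

variable {ι : Type*} [Fintype ι]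

/-- `B` is the list of summands of a Minkowski cell `∑ i, B i` of `∑ i, P i`: each `B i` is the
convex hull of some (nonempty) set of vertices of `P i`, and the cell has full dimension. -/
def IsMinkowskiCell (P B : ι → Set E) : Prop :=
  (∀ i, ∃ S : Set E, S ⊆ (P i).extremePoints ℝ ∧ S.Nonempty ∧ B i = convexHull ℝ S) ∧
    dim (∑ i, B i) = dim (∑ i, P i)

/-- `𝒞` is the set of cells of a fine mixed subdivision of the Minkowski sum `∑ i, P i`.
Cells are closed polytopes; faces of a polytope are its exposed faces (including the empty face
and the polytope itself). -/
structure IsFineMixedSubdivision [TopologicalSpace E] (P : ι → Set E) (𝒞 : Set (Set E)) :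
    Prop where
  cell : ∀ C ∈ 𝒞, ∃ B : ι → Set E, C = ∑ i, B i ∧ IsMinkowskiCell P B ∧
    (∀ i, IsSimplex (B i)) ∧ ∑ i, dim (B i) = dim (∑ i, P i)
  cover : ⋃₀ 𝒞 = ∑ i, P i
  face : ∀ C ∈ 𝒞, ∀ D ∈ 𝒞, IsExposed ℝ C (C ∩ D) ∧ IsExposed ℝ D (C ∩ D)

/-- `F` is a facet of the polytope `P`: a nonempty face of codimension one. -/
def IsFacet [TopologicalSpace E] (P F : Set E) : Prop :=
  IsExposed ℝ P F ∧ F.Nonempty ∧ dim F + 1 = dim P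

end Minkowski

/-! ### Generalized permutohedra

Left vertices are `Sum.inl i`, right vertices are `Sum.inr j`; the right vertex `1̄` is
`Sum.inr 0`, and the first coordinate of `ℝⁿ` is the one with index `0`. -/

section Permutohedron

variable {m n : ℕ}

/-- The coordinate simplex `Δ_I`, the convex hull of the `e_j` with `j ∈ I`. -/
def simplex (I : Set (Fin n)) : Set (Fin n → ℝ) :=
  convexHull ℝ ((fun j => (Pi.single j 1 : Fin n → ℝ)) '' I)

/-- The semi-simplex `Δ*_{I,j} = Δ_I \ Δ_{I \ j}`. -/
def semiSimplex (I : Set (Fin n)) (j : Fin n) : Set (Fin n → ℝ) :=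
  simplex I \ simplex (I \ {j})

/-- The set `I_i` of (indices of) right vertices adjacent to the left vertex `i`. -/
def nbr (G : SimpleGraph (Fin m ⊕ Fin n)) (i : Fin m) : Set (Fin n) :=
  {j | G.Adj (Sum.inl i) (Sum.inr j)}

/-- `y_1 Δ_{I_1} + ⋯ + y_m Δ_{I_m}`, where `I_i` is the neighbourhood of `i` in `G`. For the whole
graph this is the generalized permutohedron `P_G(y)`, for a spanning tree `T` it is `∏_T`. -/
def permutohedron (G : SimpleGraph (Fin m ⊕ Fin n)) (y : Fin m → ℕ) : Set (Fin n → ℝ) :=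
  ∑ i, (y i : ℝ) • simplex (nbr G i)

/-- The trimmed generalized permutohedron `P_G^-(y)`. -/
def trimmed (G : SimpleGraph (Fin m ⊕ Fin n)) (y : Fin m → ℕ) : Set (Fin n → ℝ) :=
  {x | ({x} : Set (Fin n → ℝ)) + simplex Set.univ ⊆ permutohedron G y}

/-- `T` is a spanning tree of `G`. -/
def IsSpanningTree (T G : SimpleGraph (Fin m ⊕ Fin n)) : Prop :=
  T ≤ G ∧ T.IsTree

/-- An integer vector, as a lattice point of `ℝⁿ`. -/
def toReal (p : Fin n → ℤ) : Fin n → ℝ := fun j => (p j : ℝ)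

variable [NeZero n]

/-- `j` is a neighbour of the left vertex `i` in `T` from which some path in `T` leads to `1̄`
without passing through `i`. (If `1̄` is itself a neighbour of `i`, then `j = 1̄` qualifies through
the path of length zero.) -/
def IsTowardsOne (T : SimpleGraph (Fin m ⊕ Fin n)) (i : Fin m) (j : Fin n) : Prop :=
  j ∈ nbr T i ∧ ∃ w : T.Walk (Sum.inr j) (Sum.inr 0), w.IsPath ∧ Sum.inl i ∉ w.support

/-- The vertex `t_i`: the `j` with `IsTowardsOne T i j`, which is unique in a tree `T`. -/
def towardsOne (T : SimpleGraph (Fin m ⊕ Fin n)) (i : Fin m) : Fin n :=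
  Classical.epsilon (IsTowardsOne T i)

/-- The semi-polytope `∑ i, y_i Δ*_{T_i, t_i}`. -/
def semiPolytope (T : SimpleGraph (Fin m ⊕ Fin n)) (y : Fin m → ℕ) : Set (Fin n → ℝ) :=
  ∑ i, (y i : ℝ) • semiSimplex (nbr T i) (towardsOne T i)

/-- The point `((n-1)c + Y, -c, …, -c)` of the hyperplane `∑ x_j = Y`, which for large `c` plays
the role of `∞₁`. -/
def inftyOne (Y c : ℝ) : Fin n → ℝ :=
  fun j => if j = 0 then ((n : ℝ) - 1) * c + Y else -c

/-- For a polytope `P` of dimension `n - 1` in the hyperplane `∑ x_j = Y`: `F` is a facet of `P`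
whose defining hyperplane (its affine span, inside `∑ x_j = Y`) separates `∞₁` from the interior of
`P`. -/
def IsNegativeFacet (Y : ℝ) (P F : Set (Fin n → ℝ)) : Prop :=
  IsFacet P F ∧ ∀ᶠ c in Filter.atTop, ∀ z ∈ intrinsicInterior ℝ P,
    (affineSpan ℝ F).SOppSide (inftyOne Y c) z

/-- A facet that is not negative. -/
def IsPositiveFacet (Y : ℝ) (P F : Set (Fin n → ℝ)) : Prop :=
  IsFacet P F ∧ ¬ IsNegativeFacet Y P F

/-- `P_G(y)` with its positive facets removed. -/
def goodPoints (G : SimpleGraph (Fin m ⊕ Fin n)) (y : Fin m → ℕ) : Set (Fin n → ℝ) :=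
  permutohedron G y \ ⋃₀ {F | IsPositiveFacet (∑ i, (y i : ℝ)) (permutohedron G y) F}

end Permutohedron

end GenPerm

end

open scoped Pointwise

noncomputable section

namespace GenPerm

section

open Filter Topology

variable {m n : ℕ}

/-! ### Points of coordinate simplices and of their Minkowski sums -/

/-! Write x(J) for the sum of the coordinates of x indexed by J, and b(J) for `lowerBound H y J`,
the sum of the y_i over those i whose neighbours all lie in J. Inside the hyperplane ∑ x_j = ∑ y_i,
the polytope ∏_H is cut out by the inequalities b(J) ≤ x(J) (`mem_permutohedron_iff_lowerBound_le`).
A move along `awayDir`, directly away from ∞₁, decreases x(J) if 0 ∈ J ≠ univ and increases it if J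
is nonempty and 0 ∉ J. So a point of ∏_H can be pushed a little in that direction without leaving
∏_H exactly when it lies in `good H y`, and small pushes then make every nontrivial inequality
strict.

All objects in the theorem are expressed through `good`. Removing the positive facets of P_G leaves
`good G y` (`goodPoints_eq_good`). For lattice points, a strict inequality has a whole unit of
slack, which is what exchanging e_1 for another e_j needs (`toReal_mem_trimmed_iff`). For a cell
∏_T, the semi-polytope is `good T y` (`semiPolytope_eq_good`): deleting i from T splits off the
component of 1̄, and the corresponding inequality measures the t_i-coordinate of the i-th summand.

It remains to see that `good G y` is the disjoint union of the sets `good T y` over the cells.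
Pushing a good point along `awayDir` brings it into the interior of a cell
(`exists_mem_good_of_cover`), and cells that meet in common faces cannot share an interior point
unless they are equal (`permutohedron_eq_of_mem_good`). That cells come from spanning trees is a
count: full dimension forces connectedness, and the dimensions of the summands bound the number of
edges (`exists_isSpanningTree_of_cell`). -/

lemma mem_simplex_iff {I : Set (Fin n)} {x : Fin n → ℝ} :
    x ∈ simplex I ↔ (∀ j, 0 ≤ x j) ∧ (∀ j, j ∉ I → x j = 0) ∧ ∑ j, x j = 1 := by
  classical
  constructor
  · intro hx
    refine convexHull_min (t := {x : Fin n → ℝ | (∀ j, 0 ≤ x j) ∧ (∀ j, j ∉ I → x j = 0) ∧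
      ∑ j, x j = 1}) ?_ ?_ hx
    · rintro _ ⟨k, hk, rfl⟩
      refine ⟨fun j => ?_, fun j hj => ?_, ?_⟩
      · by_cases h : j = k
        · subst h; simp
        · simp [h]
      · have : j ≠ k := fun h => hj (h ▸ hk)
        simp [this]
      · simp
    · rintro u ⟨hu0, hu1, hu2⟩ v ⟨hv0, hv1, hv2⟩ a b ha hb hab
      refine ⟨fun j => ?_, fun j hj => ?_, ?_⟩
      · have := mul_nonneg ha (hu0 j)
        have := mul_nonneg hb (hv0 j)
        simp only [Pi.add_apply, Pi.smul_apply, smul_eq_mul]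
        linarith
      · simp [hu1 j hj, hv1 j hj]
      · simp [Finset.sum_add_distrib, ← Finset.mul_sum, hu2, hv2, hab]
  · rintro ⟨h0, h1, h2⟩
    have hx : x = ∑ j ∈ Finset.univ.filter (· ∈ I), x j • (Pi.single j 1 : Fin n → ℝ) := by
      rw [Finset.sum_filter]
      conv_lhs => rw [pi_eq_sum_univ' x]
      refine Finset.sum_congr rfl fun j _ => ?_
      split_ifs with hj
      · congr 1
      · rw [h1 j hj, zero_smul]
    rw [hx]
    refine (convex_convexHull ℝ _).sum_mem (fun j _ => h0 j) ?_ ?_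
    · rw [← h2, Finset.sum_filter]
      refine Finset.sum_congr rfl fun j _ => ?_
      split_ifs with hj
      · rfl
      · rw [h1 j hj]
    · intro j hj
      exact subset_convexHull ℝ _ ⟨j, (Finset.mem_filter.1 hj).2, rfl⟩

lemma single_mem_simplex {I : Set (Fin n)} {j : Fin n} (hj : j ∈ I) :
    (Pi.single j 1 : Fin n → ℝ) ∈ simplex I :=
  subset_convexHull ℝ _ ⟨j, hj, rfl⟩

lemma mem_permutohedron_iff {H : SimpleGraph (Fin m ⊕ Fin n)} {y : Fin m → ℕ}
    {x : Fin n → ℝ} : x ∈ permutohedron H y ↔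
      ∃ a : Fin m → Fin n → ℝ, (∀ i, a i ∈ simplex (nbr H i)) ∧ ∑ i, (y i : ℝ) • a i = x := by
  rw [permutohedron, Set.mem_fintype_sum]
  constructor
  · rintro ⟨g, hg, rfl⟩
    choose a ha hag using fun i => Set.mem_smul_set.1 (hg i)
    exact ⟨a, ha, Finset.sum_congr rfl fun i _ => hag i⟩
  · rintro ⟨a, ha, rfl⟩
    exact ⟨fun i => (y i : ℝ) • a i, fun i => Set.smul_mem_smul_set (ha i), rfl⟩

lemma convex_permutohedron (H : SimpleGraph (Fin m ⊕ Fin n)) (y : Fin m → ℕ) :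
    Convex ℝ (permutohedron H y) :=
  convex_sum _ fun _ _ => (convex_convexHull ℝ _).smul _

lemma isCompact_permutohedron (H : SimpleGraph (Fin m ⊕ Fin n)) (y : Fin m → ℕ) :
    IsCompact (permutohedron H y) := by
  unfold permutohedron
  refine Finset.sum_induction _ IsCompact (fun _ _ => IsCompact.add) isCompact_singleton ?_
  intro i _
  exact ((Set.toFinite _).isCompact_convexHull ℝ).smul _

/-! ### The inequality description -/

open Classical in
/-- The minimum of `∑ j ∈ J, x j` over the polytope `∏_H`. -/
def lowerBound (H : SimpleGraph (Fin m ⊕ Fin n)) (y : Fin m → ℕ) (J : Finset (Fin n)) : ℝ :=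
  ∑ i, if nbr H i ⊆ ↑J then (y i : ℝ) else 0

lemma sum_sum_smul (y : Fin m → ℕ) (a : Fin m → Fin n → ℝ) (J : Finset (Fin n)) :
    ∑ j ∈ J, (∑ i, (y i : ℝ) • a i) j = ∑ i, (y i : ℝ) * ∑ j ∈ J, a i j := by
  simp only [Finset.sum_apply, Pi.smul_apply, smul_eq_mul]
  rw [Finset.sum_comm]
  simp [Finset.mul_sum]

lemma sum_eq_one_of_mem_simplex {I : Set (Fin n)} {x : Fin n → ℝ} (hx : x ∈ simplex I)
    {J : Finset (Fin n)} (h : I ⊆ ↑J) : ∑ j ∈ J, x j = 1 := by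
  obtain ⟨-, h1, h2⟩ := mem_simplex_iff.1 hx
  rw [← h2]
  exact Finset.sum_subset (Finset.subset_univ _) fun j _ hj => h1 j fun hI => hj (h hI)

lemma sum_nonneg_of_mem_simplex {I : Set (Fin n)} {x : Fin n → ℝ} (hx : x ∈ simplex I)
    (J : Finset (Fin n)) : 0 ≤ ∑ j ∈ J, x j :=
  Finset.sum_nonneg fun j _ => (mem_simplex_iff.1 hx).1 j

lemma sum_eq_zero_of_mem_simplex {I : Set (Fin n)} {x : Fin n → ℝ} (hx : x ∈ simplex I)
    {J : Finset (Fin n)} (h : ∀ j ∈ I, j ∉ J) : ∑ j ∈ J, x j = 0 :=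
  Finset.sum_eq_zero fun j hj => (mem_simplex_iff.1 hx).2.1 j fun hI => h j hI hj

lemma sum_eq_of_mem_permutohedron {H : SimpleGraph (Fin m ⊕ Fin n)} {y : Fin m → ℕ}
    {x : Fin n → ℝ} (hx : x ∈ permutohedron H y) : ∑ j, x j = ∑ i, (y i : ℝ) := by
  obtain ⟨a, ha, rfl⟩ := mem_permutohedron_iff.1 hx
  rw [sum_sum_smul]
  exact Finset.sum_congr rfl fun i _ => by
    rw [(mem_simplex_iff.1 (ha i)).2.2, mul_one]

lemma ite_le_mul_sum {H : SimpleGraph (Fin m ⊕ Fin n)} (y : Fin m → ℕ) {i : Fin m}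
    {a : Fin n → ℝ} (ha : a ∈ simplex (nbr H i)) (J : Finset (Fin n))
    [Decidable (nbr H i ⊆ ↑J)] :
    (if nbr H i ⊆ ↑J then (y i : ℝ) else 0) ≤ (y i : ℝ) * ∑ j ∈ J, a j := by
  split_ifs with h
  · rw [sum_eq_one_of_mem_simplex ha h, mul_one]
  · exact mul_nonneg (Nat.cast_nonneg _) (sum_nonneg_of_mem_simplex ha J)

lemma lowerBound_le_of_mem_permutohedron {H : SimpleGraph (Fin m ⊕ Fin n)} {y : Fin m → ℕ}
    {x : Fin n → ℝ} (hx : x ∈ permutohedron H y) (J : Finset (Fin n)) :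
    lowerBound H y J ≤ ∑ j ∈ J, x j := by
  classical
  obtain ⟨a, ha, rfl⟩ := mem_permutohedron_iff.1 hx
  rw [sum_sum_smul]
  exact Finset.sum_le_sum fun i _ => ite_le_mul_sum y (ha i) J

/-- This extends the set inequalities to all linear functionals `f`, by induction on the number of
values of `f`. Capping `f` at its second largest value M' lowers the right side by (M - M') x(J),
where J is the top level set. It lowers the left side by at most (M - M') b(J), since g_i > M' is
possible only if all neighbours of i lie in J. -/
lemma sum_mul_le_of_forall_lowerBound_le {H : SimpleGraph (Fin m ⊕ Fin n)} {y : Fin m → ℕ}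
    (hH : ∀ i, (nbr H i).Nonempty) {x : Fin n → ℝ} (hx : ∑ j, x j = ∑ i, (y i : ℝ))
    (hJ : ∀ J, lowerBound H y J ≤ ∑ j ∈ J, x j) (f : Fin n → ℝ) (g : Fin m → ℝ)
    (hgf : ∀ i, ∀ j ∈ nbr H i, g i ≤ f j) : ∑ i, (y i : ℝ) * g i ≤ ∑ j, x j * f j := by
  classical
  induction hk : (Finset.univ.image f).card using Nat.strong_induction_on generalizing f g with
  | _ k ih =>
  by_cases hm : (Finset.univ.image f).Nonempty
  swap
  · have h0 : IsEmpty (Fin m) := by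
      refine ⟨fun i => ?_⟩
      obtain ⟨j, -⟩ := hH i
      exact hm ⟨f j, Finset.mem_image_of_mem f (Finset.mem_univ j)⟩
    have h1 : IsEmpty (Fin n) :=
      ⟨fun j => hm ⟨f j, Finset.mem_image_of_mem f (Finset.mem_univ j)⟩⟩
    simp
  set M := (Finset.univ.image f).max' hm with hM
  have hfM : ∀ j, f j ≤ M := fun j =>
    Finset.le_max' _ _ (Finset.mem_image_of_mem f (Finset.mem_univ j))
  by_cases hm' : ((Finset.univ.image f).erase M).Nonempty
  swap
  · have hf : ∀ j, f j = M := by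
      intro j
      by_contra h
      exact hm' ⟨f j, Finset.mem_erase.2 ⟨h, Finset.mem_image_of_mem f (Finset.mem_univ j)⟩⟩
    calc ∑ i, (y i : ℝ) * g i ≤ ∑ i, (y i : ℝ) * M := by
          refine Finset.sum_le_sum fun i _ => ?_
          obtain ⟨j, hj⟩ := hH i
          exact mul_le_mul_of_nonneg_left ((hgf i j hj).trans (hfM j)) (Nat.cast_nonneg _)
      _ = ∑ j, x j * f j := by simp_rw [hf, ← Finset.sum_mul, hx]
  set M' := ((Finset.univ.image f).erase M).max' hm' with hM'
  have hM'mem := Finset.max'_mem _ hm'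
  rw [← hM', Finset.mem_erase] at hM'mem
  have hlt : M' < M := lt_of_le_of_ne (Finset.le_max' _ _ hM'mem.2) hM'mem.1
  have hfM' : ∀ j, f j ≠ M → f j ≤ M' := fun j hj =>
    Finset.le_max' _ _ (Finset.mem_erase.2 ⟨hj, Finset.mem_image_of_mem f (Finset.mem_univ j)⟩)
  set J := Finset.univ.filter (fun j => f j = M) with hJdef
  have key := ih ((Finset.univ.image fun j => min (f j) M').card) (by
      rw [← hk]
      refine Finset.card_lt_card ?_
      refine (Finset.ssubset_iff_of_subset ?_).2 ⟨M, Finset.max'_mem _ hm, ?_⟩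
      · intro r hr
        obtain ⟨j, -, rfl⟩ := Finset.mem_image.1 hr
        rcases min_choice (f j) M' with h | h <;> rw [h]
        · exact Finset.mem_image_of_mem f (Finset.mem_univ j)
        · exact hM'mem.2
      · intro h
        obtain ⟨j, -, hj⟩ := Finset.mem_image.1 h
        have := min_le_right (f j) M'
        linarith)
    (fun j => min (f j) M') (fun i => min (g i) M')
    (fun i j hj => min_le_min_right _ (hgf i j hj)) rfl
  have hx' : ∑ j, x j * f j = ∑ j, x j * min (f j) M' + (M - M') * ∑ j ∈ J, x j := by
    rw [hJdef, Finset.sum_filter, Finset.mul_sum, ← Finset.sum_add_distrib]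
    refine Finset.sum_congr rfl fun j _ => ?_
    split_ifs with h
    · rw [h, min_eq_right hlt.le]; ring
    · rw [min_eq_left (hfM' j h)]; ring
  have hy' : ∑ i, (y i : ℝ) * g i ≤
      ∑ i, (y i : ℝ) * min (g i) M' + (M - M') * lowerBound H y J := by
    rw [lowerBound, Finset.mul_sum, ← Finset.sum_add_distrib]
    refine Finset.sum_le_sum fun i _ => ?_
    have hyi : (0 : ℝ) ≤ y i := Nat.cast_nonneg _
    split_ifs with h
    · obtain ⟨j, hj⟩ := hH i
      have hgM := (hgf i j hj).trans (hfM j)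
      have : g i ≤ min (g i) M' + (M - M') := by
        rcases min_choice (g i) M' with h | h <;> rw [h] <;> linarith
      nlinarith [mul_le_mul_of_nonneg_left this hyi]
    · obtain ⟨j, hj, hjJ⟩ := Set.not_subset.1 h
      have : f j ≠ M := fun h => hjJ (by simp [hJdef, h])
      rw [min_eq_left ((hgf i j hj).trans (hfM' j this))]
      linarith
  rw [hx']
  refine hy'.trans (add_le_add key ?_)
  exact mul_le_mul_of_nonneg_left (hJ J) (by linarith)

lemma sum_mul_apply_single (l : StrongDual ℝ (Fin n → ℝ)) (x : Fin n → ℝ) :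
    l x = ∑ j, x j * l (Pi.single j 1) := by
  conv_lhs => rw [pi_eq_sum_univ' x]
  rw [map_sum]
  refine Finset.sum_congr rfl fun j _ => ?_
  rw [map_smul, smul_eq_mul]

/-- The polytope `∏_H` is cut out by the inequalities `lowerBound H y J ≤ ∑ j ∈ J, x j`. -/
lemma mem_permutohedron_iff_lowerBound_le {H : SimpleGraph (Fin m ⊕ Fin n)} {y : Fin m → ℕ}
    (hH : ∀ i, (nbr H i).Nonempty) {x : Fin n → ℝ} :
    x ∈ permutohedron H y ↔
      ∑ j, x j = ∑ i, (y i : ℝ) ∧ ∀ J, lowerBound H y J ≤ ∑ j ∈ J, x j := by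
  refine ⟨fun hx => ⟨sum_eq_of_mem_permutohedron hx, lowerBound_le_of_mem_permutohedron hx⟩, ?_⟩
  rintro ⟨hx, hJ⟩
  by_contra hnot
  obtain ⟨l, u, hlx, hl⟩ := geometric_hahn_banach_point_closed (convex_permutohedron H y)
    (isCompact_permutohedron H y).isClosed hnot
  -- A separating functional is minimised on ∏_H by putting all the weight of each i on its cheapest
  -- neighbour.
  have hmin : ∀ i, ∃ j ∈ nbr H i, ∀ k ∈ nbr H i,
      l (Pi.single j 1 : Fin n → ℝ) ≤ l (Pi.single k 1 : Fin n → ℝ) := fun i =>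
    Set.exists_min_image _ _ (Set.toFinite _) (hH i)
  choose c hc hcmin using hmin
  have h1 := hl (∑ i, (y i : ℝ) • (Pi.single (c i) 1 : Fin n → ℝ))
    (mem_permutohedron_iff.2 ⟨_, fun i => single_mem_simplex (hc i), rfl⟩)
  have h2 := sum_mul_le_of_forall_lowerBound_le hH hx hJ
    (fun j => l (Pi.single j 1)) (fun i => l (Pi.single (c i) 1)) hcmin
  rw [← sum_mul_apply_single] at h2
  simp only [map_sum, map_smul, smul_eq_mul] at h1
  linarith

/-! ### Moving inside the polytope -/

lemma eventually_le_add_mul {a b c : ℝ} (h : a ≤ b) (h' : a = b → 0 ≤ c) :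
    ∀ᶠ ε in 𝓝[>] (0 : ℝ), a ≤ b + ε * c := by
  rcases h.lt_or_eq with hlt | heq
  · have : Tendsto (fun ε : ℝ => b + ε * c) (𝓝 0) (𝓝 (b + 0 * c)) :=
      (Continuous.tendsto (by fun_prop) 0)
    rw [zero_mul, add_zero] at this
    exact ((this.eventually (lt_mem_nhds hlt)).mono fun _ h => h.le).filter_mono nhdsWithin_le_nhds
  · filter_upwards [self_mem_nhdsWithin] with ε hε
    have := mul_nonneg (le_of_lt hε) (h' heq)
    linarith

lemma sum_add_smul (x v : Fin n → ℝ) (ε : ℝ) (J : Finset (Fin n)) :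
    ∑ j ∈ J, (x + ε • v) j = ∑ j ∈ J, x j + ε * ∑ j ∈ J, v j := by
  simp [Finset.sum_add_distrib, Finset.mul_sum]

/-- One can move from `x` in the direction `v` if `v` respects the inequalities tight at `x`. -/
lemma eventually_add_smul_mem {H : SimpleGraph (Fin m ⊕ Fin n)} {y : Fin m → ℕ}
    (hH : ∀ i, (nbr H i).Nonempty) {x v : Fin n → ℝ} (hx : x ∈ permutohedron H y)
    (hv : ∑ j, v j = 0)
    (h : ∀ J, lowerBound H y J = ∑ j ∈ J, x j → 0 ≤ ∑ j ∈ J, v j) :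
    ∀ᶠ ε in 𝓝[>] (0 : ℝ), x + ε • v ∈ permutohedron H y := by
  simp_rw [mem_permutohedron_iff_lowerBound_le hH, sum_add_smul, hv, mul_zero, add_zero]
  rw [mem_permutohedron_iff_lowerBound_le hH] at hx
  exact (Filter.eventually_const.2 hx.1).and
    (eventually_all.2 fun J => eventually_le_add_mul (hx.2 J) (h J))

end

section

open Filter Topology

variable {m n : ℕ}

/-! ### Points visible from infinity -/

/-- The points of `∏_H` at which every inequality `lowerBound H y J ≤ ∑ j ∈ J, x j` with
`0 ∈ J ≠ univ` is strict. -/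
def good [NeZero n] (H : SimpleGraph (Fin m ⊕ Fin n)) (y : Fin m → ℕ) : Set (Fin n → ℝ) :=
  {x | x ∈ permutohedron H y ∧
    ∀ J : Finset (Fin n), 0 ∈ J → J ≠ Finset.univ → lowerBound H y J < ∑ j ∈ J, x j}

/-- The points of `∏_H` at which every nontrivial inequality is strict. -/
def strictPoints (H : SimpleGraph (Fin m ⊕ Fin n)) (y : Fin m → ℕ) : Set (Fin n → ℝ) :=
  {x | x ∈ permutohedron H y ∧
    ∀ J : Finset (Fin n), J.Nonempty → J ≠ Finset.univ → lowerBound H y J < ∑ j ∈ J, x j}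

/-- The direction `∑ j, (e_j - e_0)`, which points away from `∞₁`. -/
def awayDir [NeZero n] : Fin n → ℝ := fun j => 1 - if j = 0 then (n : ℝ) else 0

lemma sum_awayDir [NeZero n] (J : Finset (Fin n)) :
    ∑ j ∈ J, awayDir j = (J.card : ℝ) - if (0 : Fin n) ∈ J then (n : ℝ) else 0 := by
  simp [awayDir, Finset.sum_sub_distrib]

lemma sum_univ_awayDir [NeZero n] : ∑ j : Fin n, awayDir j = 0 := by
  rw [sum_awayDir]; simp

lemma sum_awayDir_neg [NeZero n] {J : Finset (Fin n)} (h0 : 0 ∈ J) (hJ : J ≠ Finset.univ) :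
    ∑ j ∈ J, (awayDir j : ℝ) < 0 := by
  rw [sum_awayDir, if_pos h0, sub_neg]
  have := Finset.card_lt_univ_of_notMem (s := J)
    (Classical.choose_spec (not_forall.1 (mt Finset.eq_univ_iff_forall.2 hJ)))
  rw [Fintype.card_fin] at this
  exact_mod_cast this

lemma sum_awayDir_pos [NeZero n] {J : Finset (Fin n)} (h0 : 0 ∉ J) (hJ : J.Nonempty) :
    0 < ∑ j ∈ J, (awayDir j : ℝ) := by
  rw [sum_awayDir, if_neg h0, sub_zero]
  exact_mod_cast hJ.card_pos

lemma eventually_lt_add_mul {a b c : ℝ} (h : a ≤ b) (h' : a = b → 0 < c) :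
    ∀ᶠ ε in 𝓝[>] (0 : ℝ), a < b + ε * c := by
  rcases h.lt_or_eq with hlt | heq
  · have : Tendsto (fun ε : ℝ => b + ε * c) (𝓝 0) (𝓝 (b + 0 * c)) :=
      (Continuous.tendsto (by fun_prop) 0)
    rw [zero_mul, add_zero] at this
    exact (this.eventually (lt_mem_nhds hlt)).filter_mono nhdsWithin_le_nhds
  · filter_upwards [self_mem_nhdsWithin] with ε hε
    have := mul_pos hε (h' heq)
    linarith

lemma lowerBound_empty {H : SimpleGraph (Fin m ⊕ Fin n)} (y : Fin m → ℕ)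
    (hH : ∀ i, (nbr H i).Nonempty) : lowerBound H y ∅ = 0 := by
  refine Finset.sum_eq_zero fun i _ => if_neg fun h => ?_
  obtain ⟨j, hj⟩ := hH i
  simpa using h hj

lemma eventually_mem_of_mem_strictPoints {H : SimpleGraph (Fin m ⊕ Fin n)} {y : Fin m → ℕ}
    (hH : ∀ i, (nbr H i).Nonempty) {x v : Fin n → ℝ} (hx : x ∈ strictPoints H y)
    (hv : ∑ j, v j = 0) : ∀ᶠ ε in 𝓝[>] (0 : ℝ), x + ε • v ∈ permutohedron H y := by
  refine eventually_add_smul_mem hH hx.1 hv fun J hJ => ?_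
  rcases J.eq_empty_or_nonempty with rfl | hne
  · simp
  by_cases hu : J = Finset.univ
  · rw [hu, hv]
  · exact absurd hJ (hx.2 J hne hu).ne

lemma sum_single_one (j : Fin n) (J : Finset (Fin n)) :
    ∑ k ∈ J, (Pi.single j 1 : Fin n → ℝ) k = if j ∈ J then 1 else 0 := by
  simp [Pi.single_apply]

lemma mem_trimmed_iff {G : SimpleGraph (Fin m ⊕ Fin n)} {y : Fin m → ℕ} {x : Fin n → ℝ} :
    x ∈ trimmed G y ↔ ∀ j, x + Pi.single j 1 ∈ permutohedron G y := by
  constructor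
  · intro h j
    exact h (Set.add_mem_add rfl (single_mem_simplex (Set.mem_univ j)))
  · rintro h _ ⟨z, rfl, v, hv, rfl⟩
    have : simplex Set.univ ⊆ (fun u => z + u) ⁻¹' permutohedron G y := by
      refine convexHull_min ?_ ((convex_permutohedron G y).translate_preimage_right z)
      rintro _ ⟨j, -, rfl⟩
      exact h j
    exact this hv

/-- From a strict point `u` one can step slightly away from any `v` of the polytope. A functional
maximal at `u` is therefore no smaller at `v`, so the face containing `u` is everything. -/
lemma permutohedron_subset_of_isExposed {H : SimpleGraph (Fin m ⊕ Fin n)} {y : Fin m → ℕ}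
    (hH : ∀ i, (nbr H i).Nonempty) {D : Set (Fin n → ℝ)} {u : Fin n → ℝ}
    (hu : u ∈ strictPoints H y) (huD : u ∈ D)
    (hD : IsExposed ℝ (permutohedron H y) (permutohedron H y ∩ D)) :
    permutohedron H y ⊆ D := by
  intro v hv
  obtain ⟨l, hl⟩ := hD ⟨u, hu.1, huD⟩
  have hmem : u ∈ permutohedron H y ∩ D := ⟨hu.1, huD⟩
  rw [hl] at hmem
  obtain ⟨δ, hδ, hδ0⟩ := ((eventually_mem_of_mem_strictPoints hH hu (v := u - v) (by
    simp [sum_eq_of_mem_permutohedron hu.1, sum_eq_of_mem_permutohedron hv])).and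
      self_mem_nhdsWithin).exists
  have h1 := hmem.2 _ hδ
  simp only [map_add, map_smul, map_sub, smul_eq_mul] at h1
  have h2 : l u ≤ l v := by
    have : δ * (l u - l v) ≤ 0 := by linarith
    have := nonpos_of_mul_nonpos_right this hδ0
    linarith
  have : v ∈ permutohedron H y ∩ D := by
    rw [hl]
    exact ⟨hv, fun w hw => (hmem.2 w hw).trans h2⟩
  exact this.2

variable [NeZero n]

/-- At a good point the only tight nontrivial inequalities have 0 ∉ J, and `awayDir` strictly
relaxes these. -/
lemma eventually_mem_strictPoints {H : SimpleGraph (Fin m ⊕ Fin n)} {y : Fin m → ℕ}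
    (hH : ∀ i, (nbr H i).Nonempty) {x : Fin n → ℝ} (hx : x ∈ good H y) :
    ∀ᶠ ε in 𝓝[>] (0 : ℝ), x + ε • awayDir ∈ strictPoints H y := by
  have hle := lowerBound_le_of_mem_permutohedron hx.1
  have h1 : ∀ J : Finset (Fin n), J.Nonempty → J ≠ Finset.univ → lowerBound H y J = ∑ j ∈ J, x j →
      0 < ∑ j ∈ J, (awayDir j : ℝ) := by
    intro J hne hu hJ
    by_cases h0 : 0 ∈ J
    · exact absurd hJ (hx.2 J h0 hu).ne
    · exact sum_awayDir_pos h0 hne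
  refine (eventually_add_smul_mem hH hx.1 sum_univ_awayDir fun J hJ => ?_).and ?_
  · rcases J.eq_empty_or_nonempty with rfl | hne
    · simp
    by_cases hu : J = Finset.univ
    · rw [hu, sum_univ_awayDir]
    · exact (h1 J hne hu hJ).le
  · simp_rw [sum_add_smul]
    refine eventually_all.2 fun J => ?_
    by_cases hne : J.Nonempty
    swap
    · exact Eventually.of_forall fun _ h => absurd h hne
    by_cases hu : J = Finset.univ
    · exact Eventually.of_forall fun _ _ h => absurd hu h
    · exact (eventually_lt_add_mul (hle J) (h1 J hne hu)).mono fun _ h _ _ => h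

lemma mem_good_of_add_smul_mem {H : SimpleGraph (Fin m ⊕ Fin n)} {y : Fin m → ℕ}
    {x : Fin n → ℝ} (hx : x ∈ permutohedron H y) {ε : ℝ} (hε : 0 < ε)
    (h : x + ε • awayDir ∈ permutohedron H y) : x ∈ good H y := by
  refine ⟨hx, fun J h0 hu => ?_⟩
  have h1 := lowerBound_le_of_mem_permutohedron h J
  rw [sum_add_smul] at h1
  have := mul_neg_of_pos_of_neg hε (sum_awayDir_neg h0 hu)
  linarith

/-! ### Gluing the cells of a subdivision -/

/-- The same small push along `awayDir` produces a point strict for both polytopes, so their common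
face is all of each. -/
lemma permutohedron_eq_of_mem_good {H K : SimpleGraph (Fin m ⊕ Fin n)} {y : Fin m → ℕ}
    (hH : ∀ i, (nbr H i).Nonempty) (hK : ∀ i, (nbr K i).Nonempty)
    (h1 : IsExposed ℝ (permutohedron H y) (permutohedron H y ∩ permutohedron K y))
    (h2 : IsExposed ℝ (permutohedron K y) (permutohedron H y ∩ permutohedron K y))
    {x : Fin n → ℝ} (hxH : x ∈ good H y) (hxK : x ∈ good K y) :
    permutohedron H y = permutohedron K y := by
  obtain ⟨ε, hεH, hεK⟩ :=
    ((eventually_mem_strictPoints hH hxH).and (eventually_mem_strictPoints hK hxK)).exists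
  refine Set.Subset.antisymm (permutohedron_subset_of_isExposed hH hεH hεK.1 h1)
    (permutohedron_subset_of_isExposed hK hεK hεH.1 ?_)
  rwa [Set.inter_comm]

lemma good_subset_good {H K : SimpleGraph (Fin m ⊕ Fin n)} {y : Fin m → ℕ}
    (hH : ∀ i, (nbr H i).Nonempty) (hsub : permutohedron H y ⊆ permutohedron K y) :
    good H y ⊆ good K y := by
  intro x hx
  obtain ⟨ε, hε, hε0⟩ := ((eventually_mem_strictPoints hH hx).and self_mem_nhdsWithin).exists
  exact mem_good_of_add_smul_mem (hsub hx.1) hε0 (hsub hε.1)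

/-- Among finitely many cells, one contains x + ε • `awayDir` for arbitrarily small ε > 0. Being
closed it contains x, and x can be pushed within it. -/
lemma exists_mem_good_of_cover {G : SimpleGraph (Fin m ⊕ Fin n)} {y : Fin m → ℕ}
    (hG : ∀ i, (nbr G i).Nonempty) {𝒞 : Set (Set (Fin n → ℝ))} (hfin : 𝒞.Finite)
    (hcover : ⋃₀ 𝒞 = permutohedron G y)
    {T : Set (Fin n → ℝ) → SimpleGraph (Fin m ⊕ Fin n)}
    (hT : ∀ C ∈ 𝒞, C = permutohedron (T C) y) {x : Fin n → ℝ} (hx : x ∈ good G y) :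
    ∃ C ∈ 𝒞, x ∈ good (T C) y := by
  have h1 : ∀ᶠ ε in 𝓝[>] (0 : ℝ), ∃ C ∈ 𝒞, x + ε • awayDir ∈ C := by
    filter_upwards [eventually_mem_strictPoints hG hx] with ε hε
    have := hε.1
    rwa [← hcover] at this
  have h2 : ∃ C ∈ 𝒞, ∃ᶠ ε in 𝓝[>] (0 : ℝ), x + ε • awayDir ∈ C := by
    by_contra! hnot
    have h3 : ∀ᶠ ε in 𝓝[>] (0 : ℝ), ∀ C ∈ 𝒞, x + ε • awayDir ∉ C :=
      (eventually_all_finite hfin).2 fun C hC => hnot C hC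
    obtain ⟨ε, ⟨C, hC, hε⟩, h4⟩ := (h1.and h3).exists
    exact h4 C hC hε
  obtain ⟨C, hC, hfreq⟩ := h2
  refine ⟨C, hC, ?_⟩
  rw [hT C hC] at hfreq
  have hxC : x ∈ permutohedron (T C) y := by
    refine (isCompact_permutohedron _ _).isClosed.mem_of_frequently_of_tendsto hfreq ?_
    have : Tendsto (fun ε : ℝ => x + ε • awayDir) (𝓝 0) (𝓝 (x + (0 : ℝ) • awayDir)) :=
      Continuous.tendsto (by fun_prop) 0
    rw [zero_smul, add_zero] at this
    exact this.mono_left nhdsWithin_le_nhds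
  obtain ⟨ε, hε, hε0⟩ := (hfreq.and_eventually self_mem_nhdsWithin).exists
  exact mem_good_of_add_smul_mem hxC hε0 hε

/-! ### Lattice points -/

lemma toReal_add_single (p : Fin n → ℤ) :
    toReal (p + Pi.single 0 1) = toReal p + Pi.single 0 1 := by
  ext j
  by_cases h : j = 0
  · subst h; simp [toReal]
  · simp [toReal, h]

/-- Shifting by `e_0` matches the lattice points of `P_G^-` with the visible ones of `P_G`. -/
lemma toReal_mem_trimmed_iff {G : SimpleGraph (Fin m ⊕ Fin n)} {y : Fin m → ℕ}
    (hG : ∀ i, (nbr G i).Nonempty) (p : Fin n → ℤ) :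
    toReal p ∈ trimmed G y ↔ toReal (p + Pi.single 0 1) ∈ good G y := by
  classical
  rw [mem_trimmed_iff, toReal_add_single]
  constructor
  · intro h
    refine ⟨h 0, fun J h0 hu => ?_⟩
    -- With j ∉ J, the point p + e_j has the same J-sum as p, one less than that of p + e_0.
    obtain ⟨j, hj⟩ := not_forall.1 (mt Finset.eq_univ_iff_forall.2 hu)
    have h1 := lowerBound_le_of_mem_permutohedron (h j) J
    simp only [Pi.add_apply, Finset.sum_add_distrib, sum_single_one, if_neg hj, if_pos h0] at h1 ⊢
    linarith
  · rintro ⟨h, hJ⟩ j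
    rw [mem_permutohedron_iff_lowerBound_le hG] at h ⊢
    refine ⟨?_, fun J => ?_⟩
    · rw [← h.1]
      simp [Finset.sum_add_distrib]
    have h1 := h.2 J
    have h2 := hJ J
    simp only [Pi.add_apply, Finset.sum_add_distrib, sum_single_one] at h1 h2 ⊢
    by_cases h0 : 0 ∈ J
    swap
    · rw [if_neg h0] at h1
      split_ifs <;> linarith
    by_cases hj : j ∈ J
    · rwa [if_pos hj, ← if_pos (c := (0 : Fin n) ∈ J) (t := (1 : ℝ)) (e := 0) h0]
    have h3 := h2 h0 fun hu => hj (hu ▸ Finset.mem_univ j)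
    rw [if_pos h0] at h3
    rw [if_neg hj, add_zero]
    -- In the case 0 ∈ J, j ∉ J the required bound is the strict one for p + e_0 with one unit
    -- removed; both sides are integers.
    have hz : lowerBound G y J =
        ((∑ i, if nbr G i ⊆ ↑J then (y i : ℤ) else 0 : ℤ) : ℝ) := by
      unfold lowerBound
      push_cast
      refine Finset.sum_congr rfl fun i _ => ?_
      split_ifs <;> simp
    have hp : ∑ k ∈ J, toReal p k = ((∑ k ∈ J, p k : ℤ) : ℝ) := by
      push_cast; rfl
    rw [hz, hp] at h3 ⊢
    norm_cast at h3 ⊢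
    omega

end

section

open SimpleGraph

variable {m n : ℕ}

lemma mem_semiSimplex_iff {I : Set (Fin n)} {j : Fin n} {x : Fin n → ℝ} :
    x ∈ semiSimplex I j ↔ x ∈ simplex I ∧ 0 < x j := by
  refine and_congr_right fun hx => ?_
  obtain ⟨h0, h1, h2⟩ := mem_simplex_iff.1 hx
  rw [mem_simplex_iff]
  constructor
  · intro h
    refine lt_of_le_of_ne (h0 j) fun hj => h ⟨h0, fun k hk => ?_, h2⟩
    by_cases hkj : k = j
    · rw [hkj, ← hj]
    · exact h1 k fun hkI => hk ⟨hkI, hkj⟩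
  · rintro hj ⟨-, h, -⟩
    exact hj.ne' (h j fun hj => hj.2 rfl)

variable [NeZero n]

/-! ### Trees and the vertices `t_i` -/

open Classical in
/-- The right vertices from which `1̄` can be reached in `T` without passing through `i`. -/
def avoiding (T : SimpleGraph (Fin m ⊕ Fin n)) (i : Fin m) : Finset (Fin n) :=
  Finset.univ.filter fun j => ∃ w : T.Walk (Sum.inr j) (Sum.inr 0), Sum.inl i ∉ w.support

lemma mem_avoiding {T : SimpleGraph (Fin m ⊕ Fin n)} {i : Fin m} {j : Fin n} :
    j ∈ avoiding T i ↔ ∃ w : T.Walk (Sum.inr j) (Sum.inr 0), Sum.inl i ∉ w.support := by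
  simp [avoiding]

lemma zero_mem_avoiding (T : SimpleGraph (Fin m ⊕ Fin n)) (i : Fin m) : 0 ∈ avoiding T i :=
  mem_avoiding.2 ⟨Walk.nil, by simp⟩

lemma isTowardsOne_iff {T : SimpleGraph (Fin m ⊕ Fin n)} {i : Fin m} {j : Fin n} :
    IsTowardsOne T i j ↔ j ∈ nbr T i ∧ j ∈ avoiding T i := by
  classical
  rw [mem_avoiding]
  refine and_congr_right fun _ => ⟨fun ⟨w, _, hw⟩ => ⟨w, hw⟩, fun ⟨w, hw⟩ => ?_⟩
  exact ⟨w.bypass, w.bypass_isPath, fun h => hw (w.support_bypass_subset_support h)⟩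

/-- A detour through i' avoids i. Hence the neighbourhood of each i' ≠ i lies entirely inside or
entirely outside `avoiding T i`. -/
lemma mem_avoiding_of_mem_nbr {T : SimpleGraph (Fin m ⊕ Fin n)} {i i' : Fin m} (hi : i' ≠ i)
    {j k : Fin n} (hj : j ∈ nbr T i') (hk : k ∈ nbr T i') (h : j ∈ avoiding T i) :
    k ∈ avoiding T i := by
  obtain ⟨w, hw⟩ := mem_avoiding.1 h
  have hj' : T.Adj (Sum.inl i') (Sum.inr j) := hj
  have hk' : T.Adj (Sum.inr k) (Sum.inl i') := Adj.symm hk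
  refine mem_avoiding.2 ⟨Walk.cons hk' (Walk.cons hj' w), ?_⟩
  simpa [hi.symm] using hw

/-- The vertex t_i is the second vertex on the unique path from i to 1̄. -/
lemma existsUnique_isTowardsOne {T : SimpleGraph (Fin m ⊕ Fin n)} (hT : T.IsTree)
    (hbip : T ≤ completeBipartiteGraph (Fin m) (Fin n)) (i : Fin m) :
    ∃! j, IsTowardsOne T i j := by
  classical
  obtain ⟨p, hp, hpu⟩ := hT.existsUnique_path (Sum.inl i) (Sum.inr 0)
  have hex : ∃ j, IsTowardsOne T i j := by
    cases p with
    | cons h q =>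
      rename_i b
      rcases b with i' | j
      · simpa using hbip h
      · rw [Walk.cons_isPath_iff] at hp
        exact ⟨j, h, q, hp.1, hp.2⟩
  obtain ⟨j, hj⟩ := hex
  refine ⟨j, hj, ?_⟩
  rintro k ⟨hk, w, hw, hwi⟩
  obtain ⟨hj, v, hv, hvi⟩ := hj
  change T.Adj (Sum.inl i) (Sum.inr k) at hk
  change T.Adj (Sum.inl i) (Sum.inr j) at hj
  have h1 := hpu (Walk.cons hk w) ((Walk.cons_isPath_iff _ _).2 ⟨hw, hwi⟩)
  have h2 := hpu (Walk.cons hj v) ((Walk.cons_isPath_iff _ _).2 ⟨hv, hvi⟩)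
  have h3 : (Walk.cons hk w).support = (Walk.cons hj v).support := by
    have : (Walk.cons hk w) = (Walk.cons hj v) := h1.trans h2.symm
    rw [this]
  rw [Walk.support_cons, Walk.support_cons, ← Walk.cons_tail_support w,
    ← Walk.cons_tail_support v] at h3
  simpa using (List.cons.inj (List.cons.inj h3).2).1

lemma isTowardsOne_towardsOne {T : SimpleGraph (Fin m ⊕ Fin n)} (hT : T.IsTree)
    (hbip : T ≤ completeBipartiteGraph (Fin m) (Fin n)) (i : Fin m) :
    IsTowardsOne T i (towardsOne T i) :=
  Classical.epsilon_spec (existsUnique_isTowardsOne hT hbip i).exists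

lemma IsTowardsOne.eq_towardsOne {T : SimpleGraph (Fin m ⊕ Fin n)} (hT : T.IsTree)
    (hbip : T ≤ completeBipartiteGraph (Fin m) (Fin n)) {i : Fin m} {j : Fin n}
    (h : IsTowardsOne T i j) : j = towardsOne T i :=
  (existsUnique_isTowardsOne hT hbip i).unique h (isTowardsOne_towardsOne hT hbip i)

lemma nbr_nonempty_of_isTree {T : SimpleGraph (Fin m ⊕ Fin n)} (hT : T.IsTree)
    (hbip : T ≤ completeBipartiteGraph (Fin m) (Fin n)) (i : Fin m) : (nbr T i).Nonempty :=
  ⟨_, (isTowardsOne_towardsOne hT hbip i).1⟩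

/-- A path to `1̄` from outside a set `J ∋ 1̄` enters `J` through some left vertex. -/
lemma exists_isTowardsOne_of_isPath {T : SimpleGraph (Fin m ⊕ Fin n)}
    (hbip : T ≤ completeBipartiteGraph (Fin m) (Fin n)) {J : Finset (Fin n)} (h0 : 0 ∈ J)
    (N : ℕ) {j : Fin n} (w : T.Walk (Sum.inr j) (Sum.inr 0)) (hN : w.length ≤ N)
    (hw : w.IsPath) (hj : j ∉ J) :
    ∃ i, ¬ nbr T i ⊆ ↑J ∧ ∃ k ∈ J, IsTowardsOne T i k := by
  induction N generalizing j with
  | zero =>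
    cases w with
    | nil => exact absurd h0 hj
    | cons h q => simp at hN
  | succ N ih =>
    cases w with
    | nil => exact absurd h0 hj
    | cons h q =>
      rename_i b
      rcases b with i | k
      swap
      · simpa using hbip h
      cases q with
      | cons h' q =>
        rename_i b
        rcases b with i' | k
        · simpa using hbip h'
        have hq := ((Walk.cons_isPath_iff _ _).1 ((Walk.cons_isPath_iff _ _).1 hw).1)
        by_cases hk : k ∈ J
        · exact ⟨i, fun hs => hj (hs (Adj.symm h)), k, hk, h', q, hq.1, hq.2⟩
        · simp only [Walk.length_cons] at hN
          exact ih q (by omega) hq.1 hk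

/-! ### Semi-polytopes -/

lemma mem_semiPolytope_iff {T : SimpleGraph (Fin m ⊕ Fin n)} {y : Fin m → ℕ} {x : Fin n → ℝ} :
    x ∈ semiPolytope T y ↔ ∃ a : Fin m → Fin n → ℝ,
      (∀ i, a i ∈ simplex (nbr T i) ∧ 0 < a i (towardsOne T i)) ∧
        ∑ i, (y i : ℝ) • a i = x := by
  rw [semiPolytope, Set.mem_fintype_sum]
  constructor
  · rintro ⟨g, hg, rfl⟩
    choose a ha hag using fun i => Set.mem_smul_set.1 (hg i)
    exact ⟨a, fun i => mem_semiSimplex_iff.1 (ha i), Finset.sum_congr rfl fun i _ => hag i⟩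
  · rintro ⟨a, ha, rfl⟩
    exact ⟨fun i => (y i : ℝ) • a i,
      fun i => Set.smul_mem_smul_set (mem_semiSimplex_iff.2 (ha i)), rfl⟩

/-- On `∏_T` the sum over `avoiding T i` depends only on the `i`-th summand. -/
lemma sum_avoiding_eq {T : SimpleGraph (Fin m ⊕ Fin n)} (hT : T.IsTree)
    (hbip : T ≤ completeBipartiteGraph (Fin m) (Fin n)) (y : Fin m → ℕ) {i : Fin m}
    (hi : ¬ nbr T i ⊆ ↑(avoiding T i)) {a : Fin m → Fin n → ℝ}
    (ha : ∀ i, a i ∈ simplex (nbr T i)) :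
    ∑ j ∈ avoiding T i, (∑ i, (y i : ℝ) • a i) j =
      lowerBound T y (avoiding T i) + y i * a i (towardsOne T i) := by
  classical
  rw [sum_sum_smul, lowerBound, ← Finset.add_sum_erase _ _ (Finset.mem_univ i),
    ← Finset.add_sum_erase (a := i) _ (fun i' => if nbr T i' ⊆ ↑(avoiding T i) then (y i' : ℝ) else 0)
      (Finset.mem_univ i), if_neg hi, zero_add, add_comm]
  congr 1
  · refine Finset.sum_congr rfl fun i' hi' => ?_
    have hne := Finset.ne_of_mem_erase hi'
    split_ifs with h
    · rw [sum_eq_one_of_mem_simplex (ha i') h, mul_one]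
    · obtain ⟨k, hk, hkJ⟩ := Set.not_subset.1 h
      rw [sum_eq_zero_of_mem_simplex (ha i') fun j hj hjJ =>
        hkJ (mem_avoiding_of_mem_nbr hne hj hk hjJ), mul_zero]
  · congr 1
    refine Finset.sum_eq_single_of_mem _
      (isTowardsOne_iff.1 (isTowardsOne_towardsOne hT hbip i)).2 fun j hj hne => ?_
    refine (mem_simplex_iff.1 (ha i)).2.1 j fun hjn => hne ?_
    exact (isTowardsOne_iff.2 ⟨hjn, hj⟩).eq_towardsOne hT hbip

/-- If 0 ∈ J ≠ univ, a path to 1̄ from outside J enters J at some t_i with i not confined to J, so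
positivity at t_i makes the J-inequality strict. Conversely, strictness for J = `avoiding T i` makes
the t_i-coordinate positive in every decomposition of x, by `sum_avoiding_eq`. The hypothesis `hy`
makes i a leaf when y_i = 0, where the i-th summand carries no information. -/
lemma semiPolytope_eq_good {T : SimpleGraph (Fin m ⊕ Fin n)} (hT : T.IsTree)
    (hbip : T ≤ completeBipartiteGraph (Fin m) (Fin n)) {y : Fin m → ℕ}
    (hy : ∀ i, y i = 0 → nbr T i ⊆ ↑(avoiding T i)) : semiPolytope T y = good T y := by
  classical
  ext x
  constructor
  · intro hx
    obtain ⟨a, ha, rfl⟩ := mem_semiPolytope_iff.1 hx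
    refine ⟨mem_permutohedron_iff.2 ⟨a, fun i => (ha i).1, rfl⟩, fun J h0 hu => ?_⟩
    obtain ⟨j, hj⟩ := not_forall.1 (mt Finset.eq_univ_iff_forall.2 hu)
    obtain ⟨p, hp, -⟩ := hT.existsUnique_path (Sum.inr j) (Sum.inr 0)
    obtain ⟨i, hi, k, hk, hik⟩ := exists_isTowardsOne_of_isPath hbip h0 p.length p le_rfl hp hj
    rw [sum_sum_smul, lowerBound]
    refine Finset.sum_lt_sum (fun i _ => ite_le_mul_sum y (ha i).1 J) ⟨i, Finset.mem_univ i, ?_⟩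
    rw [if_neg hi]
    have hkt := hik.eq_towardsOne hT hbip
    refine mul_pos ?_ ?_
    -- If y_i were 0, then t_i, which lies in J, would be the only neighbour of i.
    · refine Nat.cast_pos.2 (Nat.pos_of_ne_zero fun h => hi fun l hl => ?_)
      rw [(isTowardsOne_iff.2 ⟨hl, hy i h hl⟩).eq_towardsOne hT hbip, ← hkt]
      exact hk
    · refine Finset.sum_pos' (fun l _ => (mem_simplex_iff.1 (ha i).1).1 l) ⟨k, hk, ?_⟩
      rw [hkt]
      exact (ha i).2
  · rintro ⟨hx, hJ⟩
    obtain ⟨a, ha, rfl⟩ := mem_permutohedron_iff.1 hx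
    refine mem_semiPolytope_iff.2 ⟨a, fun i => ⟨ha i, ?_⟩, rfl⟩
    by_cases hi : nbr T i ⊆ ↑(avoiding T i)
    · have h1 := sum_eq_one_of_mem_simplex (ha i) hi
      rw [Finset.sum_eq_single_of_mem _
        (isTowardsOne_iff.1 (isTowardsOne_towardsOne hT hbip i)).2] at h1
      · rw [h1]; exact one_pos
      · intro j hj hne
        refine (mem_simplex_iff.1 (ha i)).2.1 j fun hjn => hne ?_
        exact (isTowardsOne_iff.2 ⟨hjn, hj⟩).eq_towardsOne hT hbip
    · have h1 := hJ _ (zero_mem_avoiding T i) fun hu => hi (by simp [hu])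
      rw [sum_avoiding_eq hT hbip y hi ha] at h1
      have h2 : (0 : ℝ) < y i * a i (towardsOne T i) := by linarith
      exact pos_of_mul_pos_right h2 (Nat.cast_nonneg _)

end

section

open Filter Topology

variable {m n : ℕ}

/-! ### Dimension -/

/-- The functional `x ↦ ∑ j ∈ J, x j`. -/
def sumOn (J : Finset (Fin n)) : StrongDual ℝ (Fin n → ℝ) :=
  ∑ j ∈ J, ContinuousLinearMap.proj j

lemma sumOn_apply (J : Finset (Fin n)) (x : Fin n → ℝ) : sumOn J x = ∑ j ∈ J, x j := by
  simp [sumOn]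

/-- The vectors with coordinate sum zero. -/
def zeroSum (n : ℕ) : Submodule ℝ (Fin n → ℝ) :=
  LinearMap.ker (sumOn (Finset.univ : Finset (Fin n))).toLinearMap

lemma mem_zeroSum {v : Fin n → ℝ} : v ∈ zeroSum n ↔ ∑ j, v j = 0 := by
  rw [zeroSum, LinearMap.mem_ker, ← sumOn_apply]; rfl

lemma finrank_inf_ker_add_one {V : Submodule ℝ (Fin n → ℝ)} {φ : Module.Dual ℝ (Fin n → ℝ)}
    (h : ∃ v ∈ V, φ v ≠ 0) :
    Module.finrank ℝ ↥(V ⊓ LinearMap.ker φ) + 1 = Module.finrank ℝ V := by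
  obtain ⟨v, hv, hφ⟩ := h
  have hne : φ.comp V.subtype ≠ 0 := fun h0 =>
    hφ (by simpa using LinearMap.congr_fun h0 ⟨v, hv⟩)
  rw [← Module.Dual.finrank_ker_add_one_of_ne_zero hne, LinearMap.ker_comp,
    ← Submodule.map_comap_subtype]
  congr 1
  exact Submodule.finrank_map_subtype_eq V _

lemma finrank_zeroSum [NeZero n] : Module.finrank ℝ (zeroSum n) + 1 = n := by
  have := Module.Dual.finrank_ker_add_one_of_ne_zero
    (f := (sumOn (Finset.univ : Finset (Fin n))).toLinearMap) (fun h => by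
      have h1 := LinearMap.congr_fun h (Pi.single 0 1)
      simp [sumOn] at h1)
  rwa [Module.finrank_fin_fun] at this

lemma le_vectorSpan_of_forall_exists {W : Submodule ℝ (Fin n → ℝ)} {S : Set (Fin n → ℝ)}
    {x : Fin n → ℝ} (hx : x ∈ S) (h : ∀ v ∈ W, ∃ ε > (0 : ℝ), x + ε • v ∈ S) :
    W ≤ vectorSpan ℝ S := by
  intro v hv
  obtain ⟨ε, hε, hS⟩ := h v hv
  have := vsub_mem_vectorSpan ℝ hS hx
  rw [vsub_eq_sub, add_sub_cancel_left] at this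
  exact (Submodule.smul_mem_iff _ hε.ne').1 this

lemma vectorSpan_le_ker {S : Set (Fin n → ℝ)} {l : StrongDual ℝ (Fin n → ℝ)} {r : ℝ}
    (h : ∀ x ∈ S, l x = r) : vectorSpan ℝ S ≤ LinearMap.ker l.toLinearMap := by
  rw [vectorSpan_def, Submodule.span_le]
  rintro _ ⟨u, hu, v, hv, rfl⟩
  simp [h u hu, h v hv]

lemma vectorSpan_le_zeroSum {H : SimpleGraph (Fin m ⊕ Fin n)} {y : Fin m → ℕ}
    {S : Set (Fin n → ℝ)} (hS : S ⊆ permutohedron H y) : vectorSpan ℝ S ≤ zeroSum n :=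
  vectorSpan_le_ker fun x hx => by
    rw [sumOn_apply]
    exact sum_eq_of_mem_permutohedron (hS hx)

/-- Follow a walk from J to its complement among the undeleted vertices, and mark J together with
the left vertices confined to J. The edge leaving the marked set must run from a right vertex in J
to an unconfined left vertex. -/
lemma exists_nbr_meets {G : SimpleGraph (Fin m ⊕ Fin n)}
    (hG : G ≤ completeBipartiteGraph (Fin m) (Fin n)) {y : Fin m → ℕ}
    (hconn : (G.induce {v | ∀ i : Fin m, v = Sum.inl i → 0 < y i}).Connected)
    {J : Finset (Fin n)} (hne : J.Nonempty) (hu : J ≠ Finset.univ) :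
    ∃ i, 0 < y i ∧ ¬ nbr G i ⊆ ↑J ∧ ∃ j ∈ nbr G i, j ∈ J := by
  obtain ⟨a, ha⟩ := hne
  obtain ⟨b, hb⟩ := not_forall.1 (mt Finset.eq_univ_iff_forall.2 hu)
  obtain ⟨w⟩ := hconn.preconnected ⟨Sum.inr a, by simp⟩ ⟨Sum.inr b, by simp⟩
  obtain ⟨⟨⟨⟨u, hu⟩, ⟨v, hv⟩⟩, hadj⟩, -, h1, h2⟩ := w.exists_boundary_dart
    {v | Sum.elim (fun i => nbr G i ⊆ ↑J) (fun j => j ∈ J) v.1} ha hb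
  have hadj' : G.Adj u v := hadj
  rcases u with i | j <;> rcases v with i' | j'
  · simpa using hG hadj'
  · exact absurd (h1 hadj') h2
  · exact ⟨i', hv i' rfl, h2, j, hadj'.symm, h1⟩
  · simpa using hG hadj'

/-- The witness is the sum of the scaled barycentres of the summands; connectedness supplies, for
each J, a summand that makes the inequality strict. -/
lemma strictPoints_nonempty {G : SimpleGraph (Fin m ⊕ Fin n)}
    (hG : G ≤ completeBipartiteGraph (Fin m) (Fin n)) (hne : ∀ i, (nbr G i).Nonempty)
    {y : Fin m → ℕ} (hconn : (G.induce {v | ∀ i : Fin m, v = Sum.inl i → 0 < y i}).Connected) :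
    (strictPoints G y).Nonempty := by
  classical
  set a : Fin m → Fin n → ℝ := fun i j => if j ∈ nbr G i then ((nbr G i).toFinset.card : ℝ)⁻¹ else 0
    with ha
  have hc : ∀ i, (0 : ℝ) < (nbr G i).toFinset.card := fun i => by
    exact_mod_cast (Set.toFinset_nonempty.2 (hne i)).card_pos
  have hpos : ∀ i, ∀ j ∈ nbr G i, 0 < a i j := fun i j hj => by
    simp only [ha, if_pos hj]
    exact inv_pos.2 (hc i)
  have hmem : ∀ i, a i ∈ simplex (nbr G i) := fun i => by
    refine mem_simplex_iff.2 ⟨fun j => ?_, fun j hj => if_neg hj, ?_⟩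
    · by_cases hj : j ∈ nbr G i
      · exact (hpos i j hj).le
      · exact (if_neg hj).ge
    · simp only [ha]
      rw [← Finset.sum_filter, Finset.sum_const, nsmul_eq_mul]
      have : Finset.univ.filter (· ∈ nbr G i) = (nbr G i).toFinset := by ext; simp
      rw [this, mul_inv_cancel₀ (hc i).ne']
  refine ⟨_, mem_permutohedron_iff.2 ⟨a, hmem, rfl⟩, fun J hJ hu => ?_⟩
  obtain ⟨i, hi, hsub, j, hj, hjJ⟩ := exists_nbr_meets hG hconn hJ hu
  rw [sum_sum_smul, lowerBound]
  refine Finset.sum_lt_sum (fun i _ => ite_le_mul_sum y (hmem i) J) ⟨i, Finset.mem_univ i, ?_⟩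
  rw [if_neg hsub]
  exact mul_pos (Nat.cast_pos.2 hi)
    (Finset.sum_pos' (fun l _ => (mem_simplex_iff.1 (hmem i)).1 l) ⟨j, hjJ, hpos i j hj⟩)

lemma vectorSpan_permutohedron {G : SimpleGraph (Fin m ⊕ Fin n)} {y : Fin m → ℕ}
    (hne : ∀ i, (nbr G i).Nonempty) (hs : (strictPoints G y).Nonempty) :
    vectorSpan ℝ (permutohedron G y) = zeroSum n := by
  refine le_antisymm (vectorSpan_le_zeroSum subset_rfl) ?_
  obtain ⟨z, hz⟩ := hs
  refine le_vectorSpan_of_forall_exists hz.1 fun v hv => ?_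
  obtain ⟨ε, h1, h2⟩ := ((eventually_mem_of_mem_strictPoints hne hz (mem_zeroSum.1 hv)).and
    self_mem_nhdsWithin).exists
  exact ⟨ε, h2, h1⟩

/-! ### Facets -/

lemma exists_add_smul_sub_mem_of_mem_intrinsicInterior {P : Set (Fin n → ℝ)} {z v : Fin n → ℝ}
    (hz : z ∈ intrinsicInterior ℝ P) (hv : v ∈ P) : ∃ ε > (0 : ℝ), z + ε • (z - v) ∈ P := by
  obtain ⟨z', hz', rfl⟩ := mem_intrinsicInterior.1 hz
  have hmem : ∀ t : ℝ, (z' : Fin n → ℝ) + t • ((z' : Fin n → ℝ) - v) ∈ affineSpan ℝ P := fun t => by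
    have := (affineSpan ℝ P).smul_vsub_vadd_mem t z'.2 (subset_affineSpan ℝ P hv) z'.2
    rwa [vsub_eq_sub, vadd_eq_add, add_comm] at this
  have hcont : Continuous fun t : ℝ =>
      (⟨(z' : Fin n → ℝ) + t • ((z' : Fin n → ℝ) - v), hmem t⟩ : affineSpan ℝ P) :=
    Continuous.subtype_mk (by fun_prop) _
  have h0 : ((↑) ⁻¹' P : Set (affineSpan ℝ P)) ∈
      𝓝 (⟨(z' : Fin n → ℝ) + (0 : ℝ) • ((z' : Fin n → ℝ) - v), hmem 0⟩ : affineSpan ℝ P) := by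
    simpa using mem_interior_iff_mem_nhds.1 hz'
  have h1 := ((hcont.tendsto 0).eventually h0).filter_mono
    (nhdsWithin_le_nhds (s := Set.Ioi (0 : ℝ)))
  obtain ⟨ε, hε, hε0⟩ := (h1.and self_mem_nhdsWithin).exists
  exact ⟨ε, hε0, hε⟩

variable [NeZero n]

/-- The point is Y e_0 - c • `awayDir`, so the value of `l` is affine in c, and its slope decides on
which side of a hyperplane ∞₁ lies. -/
lemma apply_inftyOne (l : StrongDual ℝ (Fin n → ℝ)) (Y c : ℝ) :
    l (inftyOne Y c) = Y * l (Pi.single 0 1) +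
      c * ∑ j, (l (Pi.single 0 1) - l (Pi.single j 1)) := by
  have h : inftyOne Y c = Y • (Pi.single 0 1 : Fin n → ℝ) - c • awayDir := by
    ext j
    by_cases hj : j = 0
    · subst hj; simp [inftyOne, awayDir]; ring
    · simp [inftyOne, awayDir, hj]
  have h2 : l awayDir = - ∑ j, (l (Pi.single 0 1) - l (Pi.single j 1)) := by
    rw [sum_mul_apply_single]
    simp [awayDir, sub_mul, Finset.sum_sub_distrib]
  rw [h, map_sub, map_smul, map_smul, h2, smul_eq_mul, smul_eq_mul]
  ring

lemma sum_inftyOne (Y c : ℝ) : ∑ j : Fin n, inftyOne Y c j = Y := by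
  have := apply_inftyOne (sumOn (Finset.univ : Finset (Fin n))) Y c
  simpa [sumOn_apply] using this

lemma sumOn_inftyOne {J : Finset (Fin n)} (h0 : 0 ∈ J) (Y c : ℝ) :
    ∑ j ∈ J, inftyOne Y c j = Y + c * ((n : ℝ) - J.card) := by
  have := apply_inftyOne (sumOn J) Y c
  simpa [sumOn_apply, sum_single_one, h0, Finset.sum_sub_distrib] using this

/-- Let F be where `l` is maximal. At a good point every direction e_j - e_0 is feasible, so l(e_0)
is the largest of the l(e_j), and `l` tends to infinity towards ∞₁. Thus ∞₁ lies beyond the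
hyperplane of F, and the interior of P_G below it. -/
lemma isNegativeFacet_of_mem_good {G : SimpleGraph (Fin m ⊕ Fin n)} {y : Fin m → ℕ}
    (hne : ∀ i, (nbr G i).Nonempty) (hs : (strictPoints G y).Nonempty)
    {F : Set (Fin n → ℝ)} (hF : IsFacet (permutohedron G y) F) {x : Fin n → ℝ} (hxF : x ∈ F)
    (hx : x ∈ good G y) : IsNegativeFacet (∑ i, (y i : ℝ)) (permutohedron G y) F := by
  refine ⟨hF, ?_⟩
  obtain ⟨hexp, -, hdim⟩ := hF
  obtain ⟨l, hl⟩ := hexp ⟨x, hxF⟩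
  have hmax : ∀ v ∈ permutohedron G y, l v ≤ l x := by
    have := hxF
    rw [hl] at this
    exact this.2
  have hFl : ∀ u ∈ F, l u = l x := fun u hu => by
    rw [hl] at hu
    exact le_antisymm (hmax u hu.1) (hu.2 x hx.1)
  have hFP : F ⊆ permutohedron G y := fun u hu => by
    rw [hl] at hu
    exact hu.1
  have hspan := vectorSpan_permutohedron hne hs
  -- A functional constant on the hyperplane would expose all of P_G, which has the wrong dimension
  -- for a facet.
  have hnc : ∃ v ∈ zeroSum n, l.toLinearMap v ≠ 0 := by
    by_contra! hc
    have : F = permutohedron G y := by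
      refine Set.Subset.antisymm hFP fun v hv => ?_
      have hlv : l v = l x := by
        have := hc (v - x) (by
          rw [← hspan]; exact vsub_mem_vectorSpan ℝ hv hx.1)
        simp only [ContinuousLinearMap.coe_coe, map_sub] at this
        linarith
      rw [hl]
      exact ⟨hv, fun w hw => hlv ▸ hmax w hw⟩
    rw [this] at hdim
    omega
  have hdir : ∀ j, l (Pi.single j 1) ≤ l (Pi.single 0 1) := by
    intro j
    have hv0 : ∑ k, ((Pi.single j 1 - Pi.single 0 1 : Fin n → ℝ)) k = 0 := by
      simp
    obtain ⟨ε, h1, h2⟩ := ((eventually_add_smul_mem hne hx.1 hv0 (fun J hJ => by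
      simp only [Pi.sub_apply, Finset.sum_sub_distrib, sum_single_one]
      by_cases hj : j ∈ J
      · rw [if_pos hj]; split_ifs <;> norm_num
      · have h0 : 0 ∉ J := fun h0 =>
          (hx.2 J h0 fun hu => hj (hu ▸ Finset.mem_univ j)).ne hJ
        rw [if_neg hj, if_neg h0, sub_zero])).and self_mem_nhdsWithin).exists
    have h3 := hmax _ h1
    simp only [map_add, map_smul, map_sub, smul_eq_mul] at h3
    have h4 : ε * (l (Pi.single j 1) - l (Pi.single 0 1)) ≤ 0 := by linarith
    have := nonpos_of_mul_nonpos_right h4 h2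
    linarith
  have hslope : 0 < ∑ j, (l (Pi.single 0 1 : Fin n → ℝ) - l (Pi.single j 1)) := by
    refine lt_of_le_of_ne (Finset.sum_nonneg fun j _ => sub_nonneg.2 (hdir j)) fun h0 => ?_
    have heq : ∀ j, l (Pi.single j 1 : Fin n → ℝ) = l (Pi.single 0 1) := fun j => by
      have := (Finset.sum_eq_zero_iff_of_nonneg fun j _ => sub_nonneg.2 (hdir j)).1 h0.symm j
        (Finset.mem_univ j)
      linarith
    obtain ⟨v, hv, hlv⟩ := hnc
    refine hlv ?_
    simp only [ContinuousLinearMap.coe_coe]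
    rw [sum_mul_apply_single]
    simp_rw [heq]
    rw [← Finset.sum_mul, mem_zeroSum.1 hv, zero_mul]
  -- Codimension one makes the affine span of F the whole level set of `l` in the hyperplane, so
  -- membership in it can be tested by `l` alone.
  have hFspan : vectorSpan ℝ F = zeroSum n ⊓ LinearMap.ker l.toLinearMap := by
    refine Submodule.eq_of_le_of_finrank_eq
      (le_inf (vectorSpan_le_zeroSum hFP) (vectorSpan_le_ker hFl)) ?_
    have h1 := finrank_inf_ker_add_one hnc
    rw [dim, dim, hspan] at hdim
    omega
  have haff : ∀ u : Fin n → ℝ, ∑ j, u j = ∑ i, (y i : ℝ) → l u = l x → u ∈ affineSpan ℝ F := by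
    intro u hu hlu
    rw [← AffineSubspace.vsub_left_mem_direction_iff_mem (subset_affineSpan ℝ F hxF),
      direction_affineSpan, hFspan]
    refine ⟨mem_zeroSum.2 ?_, ?_⟩
    · simp [hu, sum_eq_of_mem_permutohedron hx.1]
    · simp [hlu]
  have haff' : ∀ u ∈ affineSpan ℝ F, l u = l x := by
    intro u hu
    rw [← AffineSubspace.vsub_left_mem_direction_iff_mem (subset_affineSpan ℝ F hxF),
      direction_affineSpan, hFspan] at hu
    have := hu.2
    simp at this
    linarith
  have hlarge : ∀ᶠ c in atTop, l x < l (inftyOne (∑ i, (y i : ℝ)) c) := by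
    simp_rw [apply_inftyOne]
    exact (tendsto_atTop_add_const_left _ _
      (tendsto_id.atTop_mul_const hslope)).eventually_gt_atTop _
  filter_upwards [hlarge] with c hc z hz
  have hzP := intrinsicInterior_subset hz
  have hlz : l z < l x := by
    refine lt_of_le_of_ne (hmax z hzP) fun heq => ?_
    obtain ⟨v, hv, hlv⟩ := hnc
    have hconst : ∀ w ∈ permutohedron G y, l w = l x := by
      intro w hw
      obtain ⟨ε, hε, hmem⟩ := exists_add_smul_sub_mem_of_mem_intrinsicInterior hz hw
      have h1 := hmax _ hmem
      simp only [map_add, map_smul, map_sub, smul_eq_mul] at h1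
      have h2 : ε * (l z - l w) ≤ 0 := by linarith
      have := nonpos_of_mul_nonpos_right h2 hε
      have := hmax w hw
      linarith
    rw [← hspan] at hv
    exact hlv (vectorSpan_le_ker hconst hv)
  set q := inftyOne (n := n) (∑ i, (y i : ℝ)) c with hq
  have hden : 0 < l q - l z := by linarith
  -- With this parameter the segment from z to ∞₁ crosses the level set of F; the crossing point
  -- witnesses the opposite sides.
  set t := (l x - l z) / (l q - l z) with ht
  have ht0 : 0 ≤ t := div_nonneg (by linarith) hden.le
  have ht1 : t ≤ 1 := (div_le_one hden).2 (by linarith)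
  have hp : z + t • (q - z) ∈ affineSpan ℝ F := by
    refine haff _ ?_ ?_
    · rw [sum_add_smul, sum_eq_of_mem_permutohedron hzP]
      simp [hq, sum_inftyOne, sum_eq_of_mem_permutohedron hzP]
    · simp only [map_add, map_smul, map_sub, smul_eq_mul, ht]
      field_simp
      ring
  refine ⟨⟨_, hp, _, hp, ?_⟩, fun h => hc.ne' (haff' _ h), fun h => hlz.ne (haff' _ h)⟩
  have e1 : q -ᵥ (z + t • (q - z)) = (1 - t) • (q - z) := by
    rw [vsub_eq_sub]; module
  have e2 : (z + t • (q - z)) -ᵥ z = t • (q - z) := by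
    rw [vsub_eq_sub]; module
  rw [e1, e2]
  exact ((SameRay.refl _).nonneg_smul_left (by linarith)).nonneg_smul_right ht0

end

section

open Filter Topology

variable {m n : ℕ}

/-! ### Irredundant inequalities and the positive facets -/

lemma lowerBound_univ (H : SimpleGraph (Fin m ⊕ Fin n)) (y : Fin m → ℕ) :
    lowerBound H y Finset.univ = ∑ i, (y i : ℝ) :=
  Finset.sum_congr rfl fun i _ => if_pos (by simp)

/-- An irredundant system of inequalities for `∏_H`. -/
lemma exists_irredundant {H : SimpleGraph (Fin m ⊕ Fin n)} {y : Fin m → ℕ}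
    (hH : ∀ i, (nbr H i).Nonempty) :
    ∃ 𝒥 : Finset (Finset (Fin n)), (∀ J ∈ 𝒥, J.Nonempty ∧ J ≠ Finset.univ) ∧
      (∀ x : Fin n → ℝ, ∑ j, x j = ∑ i, (y i : ℝ) → (∀ J ∈ 𝒥, lowerBound H y J ≤ ∑ j ∈ J, x j) →
        x ∈ permutohedron H y) ∧
      ∀ J ∈ 𝒥, ∃ w : Fin n → ℝ, ∑ j, w j = ∑ i, (y i : ℝ) ∧
        (∀ K ∈ 𝒥, K ≠ J → lowerBound H y K ≤ ∑ j ∈ K, w j) ∧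
        ∑ j ∈ J, w j < lowerBound H y J := by
  classical
  -- A defining family of least cardinality is irredundant; the family of all nonempty proper sets
  -- shows that one exists.
  obtain ⟨𝒥, ⟨h1, h2⟩, hmin⟩ := Set.exists_min_image
    {𝒥 : Finset (Finset (Fin n)) | (∀ J ∈ 𝒥, J.Nonempty ∧ J ≠ Finset.univ) ∧
      (∀ x : Fin n → ℝ, ∑ j, x j = ∑ i, (y i : ℝ) → (∀ J ∈ 𝒥, lowerBound H y J ≤ ∑ j ∈ J, x j) →
        x ∈ permutohedron H y)} Finset.card (Set.toFinite _)
    ⟨Finset.univ.filter fun J => J.Nonempty ∧ J ≠ Finset.univ, by simp, fun x hx hJ => by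
      refine (mem_permutohedron_iff_lowerBound_le hH).2 ⟨hx, fun J => ?_⟩
      rcases J.eq_empty_or_nonempty with rfl | hne
      · rw [lowerBound_empty y hH, Finset.sum_empty]
      by_cases hu : J = Finset.univ
      · rw [hu, lowerBound_univ, hx]
      · exact hJ J (by simp [hne, hu])⟩
  refine ⟨𝒥, h1, h2, fun J hJ => ?_⟩
  have hnot : ¬ ∀ x : Fin n → ℝ, ∑ j, x j = ∑ i, (y i : ℝ) →
      (∀ K ∈ 𝒥.erase J, lowerBound H y K ≤ ∑ j ∈ K, x j) → x ∈ permutohedron H y := fun hall =>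
    (Finset.card_erase_lt_of_mem hJ).not_ge
      (hmin (𝒥.erase J) ⟨fun K hK => h1 K (Finset.mem_of_mem_erase hK), hall⟩)
  push Not at hnot
  obtain ⟨w, hw, hK, hwP⟩ := hnot
  refine ⟨w, hw, fun K hK' hne => hK K (Finset.mem_erase.2 ⟨hne, hK'⟩), ?_⟩
  by_contra! hle
  refine hwP (h2 w hw fun K hK' => ?_)
  by_cases hKJ : K = J
  · rwa [hKJ]
  · exact hK K (Finset.mem_erase.2 ⟨hKJ, hK'⟩)

lemma exists_mem_zeroSum_sum_ne_zero {J : Finset (Fin n)} (hne : J.Nonempty)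
    (hu : J ≠ Finset.univ) : ∃ v ∈ zeroSum n, (sumOn J).toLinearMap v ≠ 0 := by
  obtain ⟨a, ha⟩ := hne
  obtain ⟨b, hb⟩ := not_forall.1 (mt Finset.eq_univ_iff_forall.2 hu)
  refine ⟨Pi.single a 1 - Pi.single b 1, mem_zeroSum.2 (by simp), ?_⟩
  simp [sumOn_apply, ha, hb]

/-- An inequality of an irredundant system defines a facet. -/
lemma isFacet_of_irredundant {G : SimpleGraph (Fin m ⊕ Fin n)} {y : Fin m → ℕ}
    (hne : ∀ i, (nbr G i).Nonempty) (hs : (strictPoints G y).Nonempty)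
    {𝒥 : Finset (Finset (Fin n))} (h1 : ∀ J ∈ 𝒥, J.Nonempty ∧ J ≠ Finset.univ)
    (h2 : ∀ x : Fin n → ℝ, ∑ j, x j = ∑ i, (y i : ℝ) →
      (∀ J ∈ 𝒥, lowerBound G y J ≤ ∑ j ∈ J, x j) → x ∈ permutohedron G y)
    {J : Finset (Fin n)} (hJ : J ∈ 𝒥) {w : Fin n → ℝ} (hw : ∑ j, w j = ∑ i, (y i : ℝ))
    (hwK : ∀ K ∈ 𝒥, K ≠ J → lowerBound G y K ≤ ∑ j ∈ K, w j)
    (hwJ : ∑ j ∈ J, w j < lowerBound G y J) :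
    IsFacet (permutohedron G y) {x ∈ permutohedron G y | ∑ j ∈ J, x j = lowerBound G y J} := by
  have hspan := vectorSpan_permutohedron hne hs
  obtain ⟨z, hzP, hz⟩ := hs
  have hzJ := hz J (h1 J hJ).1 (h1 J hJ).2
  have hsum := sum_eq_of_mem_permutohedron hzP
  -- The segment from the strict point z to w, which violates only J, crosses the J-hyperplane at
  -- this parameter. Since t < 1, the other inequalities of the family stay strict there.
  set t := (∑ j ∈ J, z j - lowerBound G y J) / (∑ j ∈ J, z j - ∑ j ∈ J, w j) with ht
  have hden : 0 < ∑ j ∈ J, z j - ∑ j ∈ J, w j := by linarith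
  have ht0 : 0 < t := div_pos (by linarith) hden
  have ht1 : t < 1 := (div_lt_one hden).2 (by linarith)
  have hsub : ∀ K : Finset (Fin n), ∑ j ∈ K, (w - z) j = ∑ j ∈ K, w j - ∑ j ∈ K, z j :=
    fun K => by simp
  set p := z + t • (w - z) with hp
  have hpsum : ∑ j, p j = ∑ i, (y i : ℝ) := by
    rw [hp, sum_add_smul, hsub, hw, hsum]; ring
  have hpJ : ∑ j ∈ J, p j = lowerBound G y J := by
    rw [hp, sum_add_smul, hsub, ht]
    field_simp
    ring
  have hpK : ∀ K ∈ 𝒥, K ≠ J → lowerBound G y K < ∑ j ∈ K, p j := by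
    intro K hK hKJ
    rw [hp, sum_add_smul, hsub]
    nlinarith [hz K (h1 K hK).1 (h1 K hK).2, hwK K hK hKJ]
  have hpP : p ∈ permutohedron G y := h2 p hpsum fun K hK => by
    by_cases hKJ : K = J
    · rw [hKJ, hpJ]
    · exact (hpK K hK hKJ).le
  refine ⟨fun _ => ⟨-sumOn J, ?_⟩, ⟨p, hpP, hpJ⟩, ?_⟩
  · ext x
    refine and_congr_right fun hx => ?_
    simp only [neg_apply, neg_le_neg_iff, sumOn_apply]
    constructor
    · intro h v hv
      rw [h]
      exact lowerBound_le_of_mem_permutohedron hv J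
    · intro h
      exact le_antisymm ((h p hpP).trans hpJ.le) (lowerBound_le_of_mem_permutohedron hx J)
  · have hF : vectorSpan ℝ {x ∈ permutohedron G y | ∑ j ∈ J, x j = lowerBound G y J} =
        zeroSum n ⊓ LinearMap.ker (sumOn J).toLinearMap := by
      refine le_antisymm (le_inf (vectorSpan_le_zeroSum fun x hx => hx.1)
        (vectorSpan_le_ker fun x hx => by rw [sumOn_apply]; exact hx.2)) ?_
      -- As only J is tight at p within the family, p can move in every direction of the
      -- J-hyperplane.
      refine le_vectorSpan_of_forall_exists (x := p) ⟨hpP, hpJ⟩ ?_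
      rintro v ⟨hv, hvJ⟩
      have hv0 := mem_zeroSum.1 hv
      have hvJ' : ∑ j ∈ J, v j = 0 := by rw [← sumOn_apply]; exact hvJ
      have hev : ∀ᶠ ε in 𝓝[>] (0 : ℝ), ∀ K ∈ 𝒥, lowerBound G y K ≤ ∑ j ∈ K, (p + ε • v) j := by
        simp_rw [sum_add_smul]
        refine (Finset.eventually_all 𝒥).2 fun K hK => ?_
        by_cases hKJ : K = J
        · refine eventually_le_add_mul ?_ fun _ => ?_
          · rw [hKJ, hpJ]
          · rw [hKJ, hvJ']
        · exact eventually_le_add_mul (hpK K hK hKJ).le fun h => absurd h (hpK K hK hKJ).ne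
      obtain ⟨ε, hε, hε0⟩ := (hev.and self_mem_nhdsWithin).exists
      refine ⟨ε, hε0, h2 _ ?_ hε, ?_⟩
      · rw [sum_add_smul, hpsum, hv0, mul_zero, add_zero]
      · rw [sum_add_smul, hpJ, hvJ', mul_zero, add_zero]
    rw [dim, dim, hF, hspan]
    exact finrank_inf_ker_add_one (exists_mem_zeroSum_sum_ne_zero (h1 J hJ).1 (h1 J hJ).2)

variable [NeZero n]

/-- For 0 ∈ J ≠ univ the J-sum of ∞₁ grows like c (n - |J|), so ∞₁ is on the same side of the
hyperplane as P_G. -/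
lemma not_isNegativeFacet {G : SimpleGraph (Fin m ⊕ Fin n)} {y : Fin m → ℕ}
    (hs : (strictPoints G y).Nonempty) {J : Finset (Fin n)} (h0 : 0 ∈ J)
    (hu : J ≠ Finset.univ) {F : Set (Fin n → ℝ)} (hFne : F.Nonempty)
    (hF : ∀ x ∈ F, ∑ j ∈ J, x j = lowerBound G y J) :
    ¬ IsNegativeFacet (∑ i, (y i : ℝ)) (permutohedron G y) F := by
  rintro ⟨-, hneg⟩
  obtain ⟨z, hz⟩ := (hs.mono fun x hx => hx.1 :
    (permutohedron G y).Nonempty).intrinsicInterior (convex_permutohedron G y)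
  have hcard : (0 : ℝ) < (n : ℝ) - J.card := by
    have := sum_awayDir_neg h0 hu
    rw [sum_awayDir, if_pos h0] at this
    linarith
  have hlarge : ∀ᶠ c in atTop, lowerBound G y J <
      ∑ j ∈ J, inftyOne (∑ i, (y i : ℝ)) c j := by
    simp_rw [sumOn_inftyOne h0]
    exact (tendsto_atTop_add_const_left _ _
      (tendsto_id.atTop_mul_const hcard)).eventually_gt_atTop _
  obtain ⟨c, hc, hlt⟩ := (hneg.and hlarge).exists
  obtain ⟨⟨p₁, hp₁, p₂, hp₂, hray⟩, -, hzF⟩ := hc z hz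
  have haff : ∀ u ∈ affineSpan ℝ F, ∑ j ∈ J, u j = lowerBound G y J := by
    intro u hu
    obtain ⟨x, hx⟩ := hFne
    rw [← AffineSubspace.vsub_left_mem_direction_iff_mem (subset_affineSpan ℝ F hx),
      direction_affineSpan] at hu
    have := vectorSpan_le_ker (l := sumOn J) (fun x hx => by rw [sumOn_apply]; exact hF x hx) hu
    rw [LinearMap.mem_ker] at this
    simp [sumOn_apply, hF x hx] at this
    linarith
  have hz' := lowerBound_le_of_mem_permutohedron (intrinsicInterior_subset hz) J
  have e1 : 0 < sumOn J (inftyOne (∑ i, (y i : ℝ)) c -ᵥ p₁) := by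
    rw [vsub_eq_sub, map_sub, sumOn_apply, sumOn_apply, haff p₁ hp₁]
    linarith
  have e2 : sumOn J (p₂ -ᵥ z) ≤ 0 := by
    rw [vsub_eq_sub, map_sub, sumOn_apply, sumOn_apply, haff p₂ hp₂]
    linarith
  rcases hray with h | h | ⟨r₁, r₂, hr₁, hr₂, h⟩
  · rw [h, map_zero] at e1
    exact lt_irrefl _ e1
  · rw [vsub_eq_zero_iff_eq] at h
    exact hzF (h ▸ hp₂)
  · have := congrArg (sumOn J) h
    rw [map_smul, map_smul, smul_eq_mul, smul_eq_mul] at this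
    nlinarith [mul_pos hr₁ e1, mul_nonneg hr₂.le (neg_nonneg.2 e2)]

/-- The points of `P_G` on no positive facet are those where the inequalities indexed by the
proper sets containing `0` are strict. -/
lemma goodPoints_eq_good {G : SimpleGraph (Fin m ⊕ Fin n)} {y : Fin m → ℕ}
    (hne : ∀ i, (nbr G i).Nonempty) (hs : (strictPoints G y).Nonempty) :
    goodPoints G y = good G y := by
  ext x
  constructor
  · rintro ⟨hx, hpos⟩
    by_contra hgood
    obtain ⟨𝒥, h1, h2, h3⟩ := exists_irredundant (y := y) hne
    -- Otherwise `awayDir` respects every tight inequality of the family, and x would be good.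
    -- Passing to the irredundant family matters because a tight inequality need not define a facet.
    have hex : ∃ J ∈ 𝒥, 0 ∈ J ∧ lowerBound G y J = ∑ j ∈ J, x j := by
      by_contra! hnot
      have hev : ∀ᶠ ε in 𝓝[>] (0 : ℝ), ∀ K ∈ 𝒥,
          lowerBound G y K ≤ ∑ j ∈ K, (x + ε • awayDir : Fin n → ℝ) j := by
        simp_rw [sum_add_smul]
        refine (Finset.eventually_all 𝒥).2 fun K hK => ?_
        refine eventually_le_add_mul (lowerBound_le_of_mem_permutohedron hx K) fun h => ?_
        exact (sum_awayDir_pos (fun h0 => hnot K hK h0 h) (h1 K hK).1).le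
      obtain ⟨ε, hε, hε0⟩ := (hev.and self_mem_nhdsWithin).exists
      refine hgood (mem_good_of_add_smul_mem hx hε0 (h2 _ ?_ hε))
      rw [sum_add_smul, sum_univ_awayDir, mul_zero, add_zero, sum_eq_of_mem_permutohedron hx]
    obtain ⟨J, hJ, h0, hJx⟩ := hex
    obtain ⟨w, hw, hwK, hwJ⟩ := h3 J hJ
    refine hpos ⟨_, ⟨isFacet_of_irredundant hne hs h1 h2 hJ hw hwK hwJ, ?_⟩, hx, hJx.symm⟩
    exact not_isNegativeFacet hs h0 (h1 J hJ).2 ⟨x, hx, hJx.symm⟩ fun u hu => hu.2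
  · intro hx
    refine ⟨hx.1, ?_⟩
    rintro ⟨F, ⟨hF, hnot⟩, hxF⟩
    exact hnot (isNegativeFacet_of_mem_good hne hs hF hxF hx)

end

section

open SimpleGraph

variable {m n : ℕ}

/-! ### Cells and spanning trees -/

lemma smul_simplex (r : ℝ) (I : Set (Fin n)) :
    r • simplex I = convexHull ℝ (r • (fun j => (Pi.single j 1 : Fin n → ℝ)) '' I) :=
  (convexHull_smul r _).symm

lemma dim_smul_simplex_add_one {r : ℝ} (hr : r ≠ 0) {I : Set (Fin n)} (hI : I.Nonempty) :
    dim (r • simplex I) + 1 = Nat.card I := by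
  classical
  have : Nonempty I := hI.to_subtype
  have hli : LinearIndependent ℝ fun j : I => r • (Pi.single (j : Fin n) 1 : Fin n → ℝ) :=
    ((Pi.linearIndependent_single_one (Fin n) ℝ).comp _ Subtype.val_injective).units_smul
      fun _ => Units.mk0 r hr
  have h1 := hli.affineIndependent.finrank_vectorSpan_add_one
  have h2 : Set.range (fun j : I => r • (Pi.single (j : Fin n) 1 : Fin n → ℝ)) =
      r • (fun j => (Pi.single j 1 : Fin n → ℝ)) '' I := by
    ext x
    simp [Set.mem_smul_set]
  rw [dim, smul_simplex, ← direction_affineSpan, affineSpan_convexHull, direction_affineSpan, ← h2,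
    h1, Nat.card_eq_fintype_card]

lemma zero_smul_simplex {I : Set (Fin n)} (hI : I.Nonempty) :
    (0 : ℝ) • simplex I = ({0} : Set (Fin n → ℝ)) := by
  obtain ⟨j, hj⟩ := hI
  exact Set.zero_smul_set ⟨_, single_mem_simplex hj⟩

/-- A hull of vertices of a dilated coordinate simplex is a dilated coordinate simplex. -/
lemma exists_eq_smul_simplex {r : ℝ} {I : Set (Fin n)} (hI : I.Nonempty)
    {S : Set (Fin n → ℝ)} (hS : S ⊆ (r • simplex I).extremePoints ℝ) (hne : S.Nonempty) :
    ∃ K ⊆ I, K.Nonempty ∧ convexHull ℝ S = r • simplex K ∧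
      Nat.card K ≤ dim (r • simplex K) + 1 := by
  by_cases hr : r = 0
  · subst hr
    obtain ⟨j, hj⟩ := hI
    -- For r = 0 the hull is the origin whatever K is; a singleton keeps |K| ≤ dim + 1, as the edge
    -- count needs.
    refine ⟨{j}, Set.singleton_subset_iff.2 hj, Set.singleton_nonempty j, ?_, by simp⟩
    rw [zero_smul_simplex ⟨j, hj⟩] at hS
    have : S = {0} := (Set.subset_singleton_iff_eq.1
      (hS.trans extremePoints_subset)).resolve_left hne.ne_empty
    rw [this, zero_smul_simplex (Set.singleton_nonempty j), convexHull_singleton]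
  · rw [smul_simplex] at hS
    have hS' := hS.trans extremePoints_convexHull_subset
    have hSeq : S = r • (fun j => (Pi.single j 1 : Fin n → ℝ)) ''
        {j ∈ I | r • (Pi.single j 1 : Fin n → ℝ) ∈ S} := by
      ext x
      constructor
      · intro hx
        obtain ⟨_, ⟨j, hj, rfl⟩, rfl⟩ := hS' hx
        exact ⟨_, ⟨j, ⟨hj, hx⟩, rfl⟩, rfl⟩
      · rintro ⟨_, ⟨j, ⟨-, hx⟩, rfl⟩, rfl⟩
        exact hx
    have hK : {j ∈ I | r • (Pi.single j 1 : Fin n → ℝ) ∈ S}.Nonempty := by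
      rw [hSeq] at hne
      obtain ⟨_, _, ⟨j, hj, rfl⟩, rfl⟩ := hne
      exact ⟨j, hj⟩
    refine ⟨_, fun j hj => hj.1, hK, ?_, (dim_smul_simplex_add_one hr hK).ge⟩
    rw [smul_simplex, ← hSeq]

/-- The bipartite graph in which the left vertex `i` has the neighbourhood `K i`. -/
def ofNbr (K : Fin m → Set (Fin n)) : SimpleGraph (Fin m ⊕ Fin n) where
  Adj u v := ∃ i, ∃ j ∈ K i, (u = Sum.inl i ∧ v = Sum.inr j) ∨ (v = Sum.inl i ∧ u = Sum.inr j)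
  symm := ⟨fun _ _ ⟨i, j, hj, h⟩ => ⟨i, j, hj, h.symm⟩⟩
  loopless := ⟨by
    rintro u ⟨i, j, hj, ⟨h, h'⟩ | ⟨h, h'⟩⟩ <;> exact absurd (h.symm.trans h') (by simp)⟩

lemma nbr_ofNbr (K : Fin m → Set (Fin n)) (i : Fin m) : nbr (ofNbr K) i = K i := by
  ext j
  simp [nbr, ofNbr]

lemma ofNbr_le {K : Fin m → Set (Fin n)} {G : SimpleGraph (Fin m ⊕ Fin n)}
    (h : ∀ i, K i ⊆ nbr G i) : ofNbr K ≤ G := by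
  rintro u v ⟨i, j, hj, ⟨rfl, rfl⟩ | ⟨rfl, rfl⟩⟩
  · exact h i hj
  · exact Adj.symm (h i hj)

lemma card_edgeSet_ofNbr_le (K : Fin m → Set (Fin n)) :
    Nat.card (ofNbr K).edgeSet ≤ ∑ i, Nat.card (K i) := by
  rw [← Nat.card_sigma]
  refine Nat.card_le_card_of_surjective
    (fun e : Σ i, K i => (⟨s(Sum.inl e.1, Sum.inr e.2.1),
      ⟨e.1, e.2.1, e.2.2, Or.inl ⟨rfl, rfl⟩⟩⟩ : (ofNbr K).edgeSet)) ?_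
  rintro ⟨e, he⟩
  induction e using Sym2.ind with
  | _ u v =>
    have he' : (ofNbr K).Adj u v := he
    obtain ⟨i, j, hj, ⟨rfl, rfl⟩ | ⟨rfl, rfl⟩⟩ := he'
    · exact ⟨⟨i, j, hj⟩, rfl⟩
    · exact ⟨⟨i, j, hj⟩, Subtype.ext Sym2.eq_swap⟩

lemma exists_sum_ne {H : SimpleGraph (Fin m ⊕ Fin n)} {y : Fin m → ℕ}
    (hspan : vectorSpan ℝ (permutohedron H y) = zeroSum n) {J : Finset (Fin n)}
    (hne : J.Nonempty) (hu : J ≠ Finset.univ) (r : ℝ) :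
    ∃ x ∈ permutohedron H y, ∑ j ∈ J, x j ≠ r := by
  by_contra! h
  obtain ⟨v, hv, hJ⟩ := exists_mem_zeroSum_sum_ne_zero hne hu
  rw [← hspan] at hv
  exact hJ (vectorSpan_le_ker (fun x hx => by rw [sumOn_apply]; exact h x hx) hv)

variable [NeZero n]

/-- If the right vertices R reachable from 1̄ were not all, each left vertex would have its
neighbours inside R or disjoint from R. Then x(R) would be constant on ∏_H, against full dimension.
-/
lemma connected_of_vectorSpan_eq {H : SimpleGraph (Fin m ⊕ Fin n)} {y : Fin m → ℕ}
    (hne : ∀ i, (nbr H i).Nonempty)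
    (hspan : vectorSpan ℝ (permutohedron H y) = zeroSum n) : H.Connected := by
  classical
  set R := Finset.univ.filter fun j : Fin n => H.Reachable (Sum.inr 0) (Sum.inr j) with hR
  have hRu : R = Finset.univ := by
    by_contra hu
    obtain ⟨x, hx, hxR⟩ := exists_sum_ne hspan ⟨0, by simp [hR]⟩ hu (lowerBound H y R)
    obtain ⟨a, ha, rfl⟩ := mem_permutohedron_iff.1 hx
    refine hxR ?_
    rw [sum_sum_smul, lowerBound]
    refine Finset.sum_congr rfl fun i _ => ?_
    split_ifs with h
    · rw [sum_eq_one_of_mem_simplex (ha i) h, mul_one]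
    · obtain ⟨k, hk, hkR⟩ := Set.not_subset.1 h
      rw [sum_eq_zero_of_mem_simplex (ha i), mul_zero]
      intro j hj hjR
      refine hkR ?_
      have hj' : H.Adj (Sum.inl i) (Sum.inr j) := hj
      have hk' : H.Adj (Sum.inl i) (Sum.inr k) := hk
      simp only [hR, Finset.coe_filter, Finset.mem_filter, Finset.mem_univ, true_and,
        Set.mem_ofPred_eq] at hjR ⊢
      exact (hjR.trans hj'.symm.reachable).trans hk'.reachable
  have hright : ∀ j, H.Reachable (Sum.inr 0) (Sum.inr j) := fun j =>
    (Finset.mem_filter.1 (hRu ▸ Finset.mem_univ j : j ∈ R)).2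
  refine (connected_iff_exists_forall_reachable H).2 ⟨Sum.inr 0, ?_⟩
  rintro (i | j)
  · obtain ⟨j, hj⟩ := hne i
    have hj' : H.Adj (Sum.inl i) (Sum.inr j) := hj
    exact (hright j).trans hj'.symm.reachable
  · exact hright j

/-- A full-dimensional sum of dilated simplices whose dimensions add up to `n - 1` is `∏_T` for a
spanning tree `T`. -/
lemma exists_isSpanningTree_of_cell {G : SimpleGraph (Fin m ⊕ Fin n)} {y : Fin m → ℕ}
    (hne : ∀ i, (nbr G i).Nonempty) {B : Fin m → Set (Fin n → ℝ)}
    (hB : ∀ i, ∃ S : Set (Fin n → ℝ),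
      S ⊆ ((y i : ℝ) • simplex (nbr G i)).extremePoints ℝ ∧ S.Nonempty ∧ B i = convexHull ℝ S)
    (hspan : vectorSpan ℝ (∑ i, B i) = zeroSum n)
    (hdim : ∑ i, dim (B i) = Module.finrank ℝ (zeroSum n)) :
    ∃ T, IsSpanningTree T G ∧ ∑ i, B i = permutohedron T y := by
  have hK : ∀ i, ∃ K ⊆ nbr G i, K.Nonempty ∧ B i = (y i : ℝ) • simplex K ∧
      Nat.card K ≤ dim ((y i : ℝ) • simplex K) + 1 := by
    intro i
    obtain ⟨S, hS, hSne, hBS⟩ := hB i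
    obtain ⟨K, hKG, hKne, hKS, hcard⟩ := exists_eq_smul_simplex (hne i) hS hSne
    exact ⟨K, hKG, hKne, hBS.trans hKS, hcard⟩
  choose K hKG hKne hBK hcard using hK
  have hperm : ∑ i, B i = permutohedron (ofNbr K) y := by
    unfold permutohedron
    exact Finset.sum_congr rfl fun i _ => by rw [hBK, nbr_ofNbr]
  rw [hperm] at hspan
  have hconn := connected_of_vectorSpan_eq (fun i => by rw [nbr_ofNbr]; exact hKne i) hspan
  refine ⟨ofNbr K, ⟨ofNbr_le hKG, isTree_iff_connected_and_card.2 ⟨hconn, ?_⟩⟩, hperm⟩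
  -- The number of edges is at most ∑ (dim B_i + 1) = (n - 1) + m, one less than the number of
  -- vertices; connectedness gives the other bound.
  refine le_antisymm ?_ hconn.card_vert_le_card_edgeSet_add_one
  have h1 : ∑ i, Nat.card (K i) ≤ ∑ i, (dim (B i) + 1) :=
    Finset.sum_le_sum fun i _ => by rw [hBK]; exact hcard i
  have h2 := card_edgeSet_ofNbr_le K
  have h3 := finrank_zeroSum (n := n)
  rw [Finset.sum_add_distrib, hdim] at h1
  simp only [Finset.sum_const, Finset.card_univ, Fintype.card_fin, smul_eq_mul, mul_one] at h1
  simp only [Nat.card_eq_fintype_card, Fintype.card_sum, Fintype.card_fin] at *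
  omega

/-- Otherwise, with y_i = 0, the sum over `avoiding T i` is constant on ∏_T by `sum_avoiding_eq`,
against full dimension. -/
lemma nbr_subset_avoiding {T : SimpleGraph (Fin m ⊕ Fin n)} (hT : T.IsTree)
    (hbip : T ≤ completeBipartiteGraph (Fin m) (Fin n)) {y : Fin m → ℕ}
    (hspan : vectorSpan ℝ (permutohedron T y) = zeroSum n) {i : Fin m} (hi : y i = 0) :
    nbr T i ⊆ ↑(avoiding T i) := by
  by_contra hsub
  obtain ⟨x, hx, hne⟩ := exists_sum_ne hspan ⟨0, zero_mem_avoiding T i⟩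
    (fun hu => hsub (by simp [hu])) (lowerBound T y (avoiding T i))
  obtain ⟨a, ha, rfl⟩ := mem_permutohedron_iff.1 hx
  refine hne ?_
  rw [sum_avoiding_eq hT hbip y hsub ha, hi, Nat.cast_zero, zero_mul, add_zero]

end

end GenPerm

/-! ### Assembly of the theorem -/

open GenPerm in
theorem theorem3p5 {m n : ℕ} [NeZero n]
    (G : SimpleGraph (Fin m ⊕ Fin n))
    (hG : G ≤ completeBipartiteGraph (Fin m) (Fin n))
    (hiso : ∀ v, ∃ w, G.Adj v w)
    (y : Fin m → ℕ)
    -- deleting the left vertices with `y i = 0` leaves a connected graph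
    (hconn : (G.induce {v | ∀ i : Fin m, v = Sum.inl i → 0 < y i}).Connected)
    (𝒞 : Set (Set (Fin n → ℝ)))
    (h𝒞 : GenPerm.IsFineMixedSubdivision
      (fun i => (y i : ℝ) • GenPerm.simplex (GenPerm.nbr G i)) 𝒞) :
    -- `p ↦ p + e₁` identifies the lattice points of `P_G^-` with the good lattice points of `P_G`
    Set.BijOn (fun p : Fin n → ℤ => p + Pi.single 0 1)
      {p | GenPerm.toReal p ∈ GenPerm.trimmed G y}
      {q | GenPerm.toReal q ∈ GenPerm.goodPoints G y} ∧
    -- every cell is `∏_T` for some spanning tree `T`, and `t_i` is well defined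
    (∀ C ∈ 𝒞, ∃ T, GenPerm.IsSpanningTree T G ∧ C = GenPerm.permutohedron T y) ∧
    (∀ T, GenPerm.IsSpanningTree T G → ∀ i, ∃! j, GenPerm.IsTowardsOne T i j) ∧
    -- the decomposition, however the cells are written as `∏_T`
    ∀ T : Set (Fin n → ℝ) → SimpleGraph (Fin m ⊕ Fin n),
      (∀ C ∈ 𝒞, GenPerm.IsSpanningTree (T C) G ∧ C = GenPerm.permutohedron (T C) y) →
      𝒞.PairwiseDisjoint (fun C => GenPerm.semiPolytope (T C) y) ∧
      (⋃ C ∈ 𝒞, GenPerm.semiPolytope (T C) y) = GenPerm.goodPoints G y ∧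
      ∀ p : Fin n → ℤ, GenPerm.toReal p ∈ GenPerm.trimmed G y →
        ∃! C, C ∈ 𝒞 ∧
          GenPerm.toReal (p + Pi.single 0 1) ∈ GenPerm.semiPolytope (T C) y := by
  have hne : ∀ i, (nbr G i).Nonempty := by
    intro i
    obtain ⟨v | j, hw⟩ := hiso (Sum.inl i)
    · simpa using hG hw
    · exact ⟨j, hw⟩
  have hs := strictPoints_nonempty hG hne hconn
  have hgood := goodPoints_eq_good hne hs
  have hspan := vectorSpan_permutohedron hne hs
  have hcover : ⋃₀ 𝒞 = permutohedron G y := h𝒞.cover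
  have hCspan : ∀ C ∈ 𝒞, vectorSpan ℝ C = zeroSum n := by
    intro C hC
    obtain ⟨B, hCB, ⟨-, hdim⟩, -, -⟩ := h𝒞.cell C hC
    rw [← hspan]
    refine Submodule.eq_of_le_of_finrank_eq (vectorSpan_mono ℝ ?_) ?_
    · rw [← hcover]
      exact Set.subset_sUnion_of_mem hC
    · rw [hCB]
      exact hdim
  have hcells : ∀ C ∈ 𝒞, ∃ T, IsSpanningTree T G ∧ C = permutohedron T y := by
    intro C hC
    obtain ⟨B, hCB, ⟨hB, -⟩, -, hsum⟩ := h𝒞.cell C hC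
    have h1 := hCspan C hC
    rw [hCB] at h1 ⊢
    refine exists_isSpanningTree_of_cell hne hB h1 (hsum.trans ?_)
    rw [← hspan]
    rfl
  have htree : ∀ T, IsSpanningTree T G → T ≤ completeBipartiteGraph (Fin m) (Fin n) :=
    fun T hT => hT.1.trans hG
  refine ⟨⟨fun p hp => ?_, fun p _ q _ h => add_right_cancel h, fun q hq => ?_⟩, hcells,
    fun T hT i => existsUnique_isTowardsOne hT.2 (htree T hT) i, fun T hT => ?_⟩
  · rw [Set.mem_ofPred_eq, hgood]
    exact (toReal_mem_trimmed_iff hne p).1 hp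
  · refine ⟨q - Pi.single 0 1, (toReal_mem_trimmed_iff hne _).2 ?_, sub_add_cancel _ _⟩
    rw [sub_add_cancel, ← hgood]
    exact hq
  · have hTne : ∀ C ∈ 𝒞, ∀ i, (nbr (T C) i).Nonempty := fun C hC =>
      nbr_nonempty_of_isTree (hT C hC).1.2 (htree _ (hT C hC).1)
    have hsemi : ∀ C ∈ 𝒞, semiPolytope (T C) y = good (T C) y := fun C hC =>
      semiPolytope_eq_good (hT C hC).1.2 (htree _ (hT C hC).1) fun i hi =>
        nbr_subset_avoiding (hT C hC).1.2 (htree _ (hT C hC).1)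
          ((hT C hC).2 ▸ hCspan C hC) hi
    have huniq : ∀ C ∈ 𝒞, ∀ D ∈ 𝒞, ∀ x, x ∈ semiPolytope (T C) y → x ∈ semiPolytope (T D) y →
        C = D := by
      intro C hC D hD x hxC hxD
      rw [hsemi C hC] at hxC
      rw [hsemi D hD] at hxD
      have hface := h𝒞.face C hC D hD
      have h := permutohedron_eq_of_mem_good (hTne C hC) (hTne D hD)
        (by rw [← (hT C hC).2, ← (hT D hD).2]; exact hface.1)
        (by rw [← (hT C hC).2, ← (hT D hD).2]; exact hface.2) hxC hxD
      rwa [← (hT C hC).2, ← (hT D hD).2] at h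
    -- Finiteness is not part of the definition of a subdivision; it holds because there are only
    -- finitely many graphs on the vertex set.
    have hfin : 𝒞.Finite := by
      refine (Set.finite_range fun H => permutohedron (m := m) (n := n) H y).subset fun C hC => ?_
      exact ⟨T C, (hT C hC).2.symm⟩
    have hunion : (⋃ C ∈ 𝒞, semiPolytope (T C) y) = goodPoints G y := by
      rw [hgood]
      ext x
      simp only [Set.mem_iUnion, exists_prop]
      constructor
      · rintro ⟨C, hC, hx⟩
        rw [hsemi C hC] at hx
        refine good_subset_good (hTne C hC) ?_ hx
        rw [← (hT C hC).2, ← hcover]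
        exact Set.subset_sUnion_of_mem hC
      · intro hx
        obtain ⟨C, hC, hxC⟩ := exists_mem_good_of_cover hne hfin hcover (fun C hC => (hT C hC).2) hx
        exact ⟨C, hC, (hsemi C hC).symm ▸ hxC⟩
    refine ⟨fun C hC D hD hCD => ?_, hunion, fun p hp => ?_⟩
    · exact Set.disjoint_left.2 fun x hxC hxD => hCD (huniq C hC D hD x hxC hxD)
    · have hq := (toReal_mem_trimmed_iff hne p).1 hp
      rw [← hgood, ← hunion] at hq
      simp only [Set.mem_iUnion, exists_prop] at hq
      obtain ⟨C, hC, hx⟩ := hq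
      exact ⟨C, ⟨hC, hx⟩, fun D hD => huniq D hD.1 C hC _ hD.2 hx⟩

end
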